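/- **Setting.** Let $I\subset\mathbb R$ be a non-degenerate compact interval and let $(I_j)_j$, $I_j=(p_j,q_j)$, be a finite or countable family of pairwise disjoint non-empty open subintervals of $I$. A map $f:\bigcup_j I_j\to I$ is a *cusp map* if - for each $j$, $f$ is a $C^1$ diffeomorphism from $I_j$ onto $f(I_j)$, and the limits $\lim_{x\to p_j^+}Df(x)$ and $\lim_{x\to q_j^-}Df(x)$ exist and equal $0$ or $\pm\infty$; - there are constants $C,\epsilon>0$ such that, for every $j$ and all $x,x'\in I_j$: if $|Df(x)|,|Df(x')|\le 2$ then $|Df(x)-Df(x')|\le C|x-x'|^\epsilon$, and if $|Df(x)|,|Df(x')|\ge \tfrac12$ then $\left|\frac1{Df(x)}-\frac1{Df(x')}\right|\le C|x-x'|^\epsilon$. Let $\mu$ be an ergodic $f$-invariant Borel probability measure such that $\log|Df|$ is $\mu$-integrable, with positive Lyapunov exponent $\chi=\int\log|Df|\,d\mu>0$. Let $Y=\{y=(y_0,y_1,y_2,\dots): f(y_{i+1})=y_i \text{ for all } i\ge 0\}$, let $F^{-1}:Y\to Y$ be the map $(y_0,y_1,\dots)\mapsto(y_1,y_2,\dots)$,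 with inverse $F:F^{-1}(Y)\to Y$, let $\Pi:Y\to I$, $\Pi(y)=y_0$, and let $\bar\mu$ be the unique $F$-invariant measure on $Y$ with $\Pi_*\bar\mu=\mu$; $(Y,F,\bar\mu)$ is the *natural extension* of $(f,\mu)$. **Theorem.** There exist a measurable function $\alpha$ on $Y$ with $0<\alpha<1/2$ $\bar\mu$-almost everywhere and, for each $\eta>0$, a measurable function $\rho=\rho_\eta$ on $Y$ with $0<\rho<\infty$ $\bar\mu$-almost everywhere, such that for $\bar\mu$-almost every $y\in Y$ there exists a set $V_y\subset Y$ with the following properties: - $y\in V_y$ and $\Pi V_y=B(\Pi y,\alpha(y))$, the open ball of centre $\Pi y$ and radius $\alpha(y)$; - for each $n>0$, $f^n:\Pi F^{-n}V_y\to\Pi V_y$ is a $C^1$ diffeomorphism (in particular it is onto); - for all $y'\in V_y$, $$\sum_{i=1}^\infty\bigl|\log|Df(\Pi F^{-i}y')|-\log|Df(\Pi F^{-i}y)|\bigr|<\log 2;$$ - for every $\eta>0$ and every integer $n\ge 0$, $$\rho_\eta(y)^{-1}e^{n(\chi-\eta)}<|Df^n(\Pi F^{-n}y)|<\rho_\eta(y)e^{n(\chi+\eta)},$$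 and the length satisfies $|\Pi F^{-n}V_y|\le\rho_\eta(y)e^{-n(\chi-\eta)}$. -/

import Mathlib

open MeasureTheory Set Filter Topology

/-- `f` restricts to a `C¹` diffeomorphism from the open set `U` of the line onto the open set
`V`. -/
def IsC1Diffeo (f : ℝ → ℝ) (U V : Set ℝ) : Prop :=
  IsOpen U ∧ IsOpen V ∧ BijOn f U V ∧ ContDiffOn ℝ 1 f U ∧
    ∃ g : ℝ → ℝ, InvOn g f U V ∧ ContDiffOn ℝ 1 g V

/-- The domain of definition `⋃ⱼ Iⱼ` of the map, where `Iⱼ = (pⱼ, qⱼ)`. -/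
def cuspDomain {ι : Type*} (p q : ι → ℝ) : Set ℝ := ⋃ j, Ioo (p j) (q j)

/-- The limit of `φ` along `l` exists and equals `0`, `+∞` or `-∞`. -/
def LimZeroOrInfinite (φ : ℝ → ℝ) (l : Filter ℝ) : Prop :=
  Tendsto φ l (𝓝 0) ∨ Tendsto φ l atTop ∨ Tendsto φ l atBot

/-- `f : ⋃ⱼ (pⱼ, qⱼ) → I = [a, b]` is a basic cusp map. The partially defined map is represented
by a total function `f : ℝ → ℝ`, whose values outside `⋃ⱼ (pⱼ, qⱼ)` are irrelevant. -/
structure IsBasicCuspMap {ι : Type*} (a b : ℝ) (p q : ι → ℝ) (f : ℝ → ℝ) : Prop where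
  left_lt_right : a < b
  nonempty : ∀ j, p j < q j
  subset : ∀ j, Ioo (p j) (q j) ⊆ Icc a b
  pairwise_disjoint : Pairwise fun i j => Disjoint (Ioo (p i) (q i)) (Ioo (p j) (q j))
  mapsTo : ∀ j, MapsTo f (Ioo (p j) (q j)) (Icc a b)
  diffeo : ∀ j, IsC1Diffeo f (Ioo (p j) (q j)) (f '' Ioo (p j) (q j))
  lim_left : ∀ j, LimZeroOrInfinite (deriv f) (𝓝[>] p j)
  lim_right : ∀ j, LimZeroOrInfinite (deriv f) (𝓝[<] q j)

/-- `f : ⋃ⱼ (pⱼ, qⱼ) → [a, b]` is a cusp map with constants `C`, `ε`. -/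
structure IsCuspMapWith {ι : Type*} (a b : ℝ) (p q : ι → ℝ) (f : ℝ → ℝ) (C ε : ℝ) : Prop where
  basic : IsBasicCuspMap a b p q f
  C_pos : 0 < C
  ε_pos : 0 < ε
  holder : ∀ j, ∀ x ∈ Ioo (p j) (q j), ∀ x' ∈ Ioo (p j) (q j),
    |deriv f x| ≤ 2 → |deriv f x'| ≤ 2 → |deriv f x - deriv f x'| ≤ C * |x - x'| ^ ε
  holder_inv : ∀ j, ∀ x ∈ Ioo (p j) (q j), ∀ x' ∈ Ioo (p j) (q j),
    2⁻¹ ≤ |deriv f x| → 2⁻¹ ≤ |deriv f x'| →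
      |1 / deriv f x - 1 / deriv f x'| ≤ C * |x - x'| ^ ε

/-- `f : ⋃ⱼ (pⱼ, qⱼ) → [a, b]` is a cusp map. -/
def IsCuspMap {ι : Type*} (a b : ℝ) (p q : ι → ℝ) (f : ℝ → ℝ) : Prop :=
  ∃ C ε : ℝ, IsCuspMapWith a b p q f C ε

/-- `μ` is invariant under the partially defined map `T : D → X`: one has `μ(T⁻¹ A) = μ(A)` for
every measurable `A`, where `T⁻¹ A = {x ∈ D | T x ∈ A}`. (Taking `A = X`, a finite invariant measure
gives no mass to the complement of `D`.) -/
def IsInvariantOn {X : Type*} [MeasurableSpace X] (D : Set X) (T : X → X) (μ : Measure X) : Prop :=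
  ∀ A, MeasurableSet A → μ (D ∩ T ⁻¹' A) = μ A

/-- `μ` is an ergodic invariant probability measure of the partially defined map `T : D → X`. -/
structure IsErgodicInvariant {X : Type*} [MeasurableSpace X] (D : Set X) (T : X → X)
    (μ : Measure X) : Prop where
  prob : IsProbabilityMeasure μ
  invariant : IsInvariantOn D T μ
  ergodic : ∀ A, MeasurableSet A → D ∩ T ⁻¹' A = A → μ A = 0 ∨ μ A = 1

/-- The space `Y` of backward orbits `y = (y₀, y₁, y₂, …)`, `f(yᵢ₊₁) = yᵢ`, of the partially defined
map `f : D → ℝ`, with the σ-algebra induced by the product `ℝ^ℕ`. -/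
abbrev BackwardOrbit (D : Set ℝ) (f : ℝ → ℝ) : Type :=
  {y : ℕ → ℝ // ∀ i, y (i + 1) ∈ D ∧ f (y (i + 1)) = y i}

namespace BackwardOrbit

variable {D : Set ℝ} {f : ℝ → ℝ}

/-- The projection `Π : Y → ℝ`, `(y₀, y₁, …) ↦ y₀`. -/
def proj (y : BackwardOrbit D f) : ℝ := y.1 0

/-- The map `F⁻¹ : Y → Y`, `(y₀, y₁, …) ↦ (y₁, y₂, …)`. -/
def Finv (y : BackwardOrbit D f) : BackwardOrbit D f := ⟨fun i => y.1 (i + 1), fun i => y.2 (i + 1)⟩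

/-- The domain of definition of `F`, which is the set `F⁻¹(Y)`. -/
def Fdomain (D : Set ℝ) (f : ℝ → ℝ) : Set (BackwardOrbit D f) := {y | y.1 0 ∈ D}

open Classical in
/-- The map `F : F⁻¹(Y) → Y`, `(y₀, y₁, …) ↦ (f(y₀), y₀, y₁, …)`, inverse to `F⁻¹ : Y → F⁻¹(Y)`
(extended by the identity outside `F⁻¹(Y)`, which is irrelevant). -/
noncomputable def F (y : BackwardOrbit D f) : BackwardOrbit D f :=
  if h : y.1 0 ∈ D then
    ⟨fun i => Nat.casesOn i (f (y.1 0)) y.1, fun i => by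
      cases i with
      | zero => exact ⟨h, rfl⟩
      | succ i => exact y.2 i⟩
  else y

/-- `F` inverts `F⁻¹` on `Y`. -/
theorem F_Finv (y : BackwardOrbit D f) : F (Finv y) = y := by
  have h : (Finv y).1 0 ∈ D := (y.2 0).1
  rw [F, dif_pos h]
  apply Subtype.ext
  funext i
  cases i with
  | zero => exact (y.2 0).2
  | succ i => rfl

/-- `F⁻¹` inverts `F` on the domain of `F`. -/
theorem Finv_F {y : BackwardOrbit D f} (h : y ∈ Fdomain D f) : Finv (F y) = y := by
  rw [F, dif_pos (show y.1 0 ∈ D from h)]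
  rfl

end BackwardOrbit

/-- `μbar` is the measure of the natural extension `(Y, F, μbar)` of `(f, μ)`: the `F`-invariant
measure on `Y` with `Π_* μbar = μ`. -/
structure IsNaturalExtension (D : Set ℝ) (f : ℝ → ℝ) (μ : Measure ℝ)
    (μbar : Measure (BackwardOrbit D f)) : Prop where
  invariant : IsInvariantOn (BackwardOrbit.Fdomain D f) BackwardOrbit.F μbar
  map_proj : μbar.map BackwardOrbit.proj = μ

open ProbabilityTheory in
/-- For a measure-preserving `g` there is a law on `ℝ^ℕ` whose marginal on the coordinates
`0, …, n` is the law of `(gⁿ x, …, g x, x)`, for every `n`. -/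
theorem exists_backward_law {μ : Measure ℝ} [IsProbabilityMeasure μ] {g : ℝ → ℝ}
    (hg : MeasurePreserving g μ μ) :
    ∃ P : Measure (ℕ → ℝ), IsProbabilityMeasure P ∧
      ∀ n : ℕ, P.map (Preorder.frestrictLe (π := fun _ => ℝ) n) =
        μ.map (fun x (i : Finset.Iic n) => g^[n - i] x) := by
  let k : Kernel ℝ ℝ := condDistrib id g μ
  have hk : μ ⊗ₘ k = μ.map (fun x => (g x, x)) := by
    have : μ.map g ⊗ₘ k = μ.map (fun x => (g x, x)) :=
      compProd_map_condDistrib (X := g) (Y := id) (μ := μ) aemeasurable_id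
    rwa [hg.map_eq] at this
  let κ (n : ℕ) : Kernel ((i : Finset.Iic n) → ℝ) ℝ :=
    k.comap (fun x => x ⟨n, Finset.mem_Iic.2 le_rfl⟩) (by fun_prop)
  have hκ (n) : IsMarkovKernel (κ n) := by dsimp only [κ]; infer_instance
  have hφ (n : ℕ) : Measurable (fun (x : ℝ) (i : Finset.Iic n) => g^[n - i] x) :=
    measurable_pi_lambda _ fun i => hg.measurable.iterate _
  let ν : Measure ((i : Finset.Iic 0) → ℝ) := μ.map (fun x (i : Finset.Iic 0) => g^[0 - i] x)
  have hν : IsProbabilityMeasure ν := Measure.isProbabilityMeasure_map (hφ 0).aemeasurable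
  have key (n : ℕ) : Kernel.partialTraj (X := fun _ => ℝ) κ 0 n ∘ₘ ν =
      μ.map (fun x (i : Finset.Iic n) => g^[n - i] x) := by
    induction n with
    | zero => simp [ν]
    | succ n ih =>
      have hpm := (MeasurableEquiv.piSingleton (X := fun _ => ℝ) n).measurable
      have hm := Kernel.IsMarkovKernel.map (κ n) hpm
      rw [Kernel.partialTraj_succ_of_le (Nat.zero_le n), ← Measure.map_comp ν _ (measurable_IicProdIoc (X := fun _ => ℝ)),
        ← Measure.comp_assoc, ih, ← Measure.compProd_eq_comp_prod]
      let G (z : ℝ × ℝ) : (i : Finset.Iic (n + 1)) → ℝ :=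
        IicProdIoc (X := fun _ => ℝ) n (n + 1)
          (fun i => g^[n - i] z.1, MeasurableEquiv.piSingleton (X := fun _ => ℝ) n z.2)
      have hG : Measurable G :=
        measurable_IicProdIoc.comp (((hφ n).comp measurable_fst).prodMk (hpm.comp measurable_snd))
      have hGx : (fun x (i : Finset.Iic (n + 1)) => g^[n + 1 - i] x) =
          G ∘ fun x => (g x, x) := by
        funext x i
        by_cases h : i.1 ≤ n
        · simp only [G, IicProdIoc_def, Function.comp, h, dif_pos]
          rw [show n + 1 - (i : ℕ) = (n - i) + 1 by omega, Function.iterate_succ_apply]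
        · have hi : i.1 = n + 1 := by have := Finset.mem_Iic.1 i.2; omega
          simp [G, IicProdIoc_def, hi, MeasurableEquiv.piSingleton]
      have hgx : Measurable (fun x => (g x, x)) := hg.measurable.prodMk measurable_id
      rw [hGx, ← Measure.map_map hG hgx, ← hk]
      ext S hS
      have hS' := measurable_IicProdIoc (X := fun _ => ℝ) (m := n) (n := n + 1) hS
      rw [Measure.map_apply (measurable_IicProdIoc (X := fun _ => ℝ)) hS, Measure.map_apply hG hS,
        Measure.compProd_apply hS', Measure.compProd_apply (hG hS),
        lintegral_map (Kernel.measurable_kernel_prodMk_left hS') (hφ n)]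
      refine lintegral_congr fun x => ?_
      rw [Kernel.map_apply' _ hpm _ (measurable_prodMk_left hS'), Kernel.comap_apply]
      simp only [Nat.sub_self, Function.iterate_zero, id]
      rfl
  refine ⟨Kernel.traj (X := fun _ => ℝ) κ 0 ∘ₘ ν, inferInstance, fun n => ?_⟩
  rw [Measure.map_comp _ _ (by fun_prop), Kernel.traj_map_frestrictLe, key]

/-- Finite measures on `ℝ^ℕ` with the same marginals on initial segments are equal. -/
theorem measure_ext_of_frestrictLe {P Q : Measure (ℕ → ℝ)} [IsFiniteMeasure P]
    (h : ∀ n : ℕ, P.map (Preorder.frestrictLe (π := fun _ => ℝ) n) =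
      Q.map (Preorder.frestrictLe (π := fun _ => ℝ) n)) : P = Q := by
  refine IsProjectiveLimit.unique (P := fun I : Finset ℕ => P.map I.restrict)
    (fun I => rfl) (fun I => ?_)
  have e : (I.restrict : (ℕ → ℝ) → (I → ℝ)) =
      Finset.restrict₂ (π := fun _ => ℝ) I.subset_Iic_sup_id ∘ Preorder.frestrictLe (π := fun _ => ℝ) (I.sup id) := by
    funext y i; rfl
  have m : Measurable (Finset.restrict₂ (π := fun _ => ℝ) I.subset_Iic_sup_id) :=
    Finset.measurable_restrict₂ _
  change Q.map I.restrict = P.map I.restrict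
  rw [e, ← Measure.map_map m (by fun_prop), ← Measure.map_map m (by fun_prop), h]

namespace BackwardOrbit

variable {D : Set ℝ} {f : ℝ → ℝ}

theorem measurable_proj : Measurable (proj : BackwardOrbit D f → ℝ) :=
  (measurable_pi_apply 0).comp measurable_subtype_coe

theorem measurable_Finv : Measurable (Finv : BackwardOrbit D f → BackwardOrbit D f) :=
  have h : Measurable (fun y : BackwardOrbit D f => fun i => y.1 (i + 1)) :=
    measurable_pi_lambda _ fun i => (measurable_pi_apply (i + 1)).comp measurable_subtype_coe
  h.subtype_mk

theorem Finv_iterate_apply (n i : ℕ) (y : BackwardOrbit D f) : (Finv^[n] y).1 i = y.1 (i + n) := by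
  induction n generalizing y with
  | zero => rfl
  | succ n ih =>
    rw [Function.iterate_succ_apply, ih]
    exact congrArg y.1 (by omega)

theorem measurableSet_Fdomain (hD : MeasurableSet D) : MeasurableSet (Fdomain D f) :=
  measurable_proj hD

theorem measurable_F (hD : MeasurableSet D) {g : ℝ → ℝ} (hg : Measurable g) (hgf : EqOn g f D) :
    Measurable (F : BackwardOrbit D f → BackwardOrbit D f) := by
  have hS := measurableSet_Fdomain (f := f) hD
  have h1 : Measurable (fun y : BackwardOrbit D f => (F y).1) := by
    refine measurable_pi_lambda _ fun i => ?_
    have e : (fun y : BackwardOrbit D f => (F y).1 i) = fun y =>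
        open Classical in
        if y ∈ Fdomain D f then (Nat.casesOn i (g (y.1 0)) y.1 : ℝ) else y.1 i := by
      funext y
      by_cases h : y.1 0 ∈ D
      · rw [F, dif_pos h, if_pos (show y ∈ Fdomain D f from h), hgf h]
      · rw [F, dif_neg h, if_neg (show y ∉ Fdomain D f from h)]
    rw [e]
    refine Measurable.ite hS ?_ ((measurable_pi_apply i).comp measurable_subtype_coe)
    cases i with
    | zero => exact hg.comp measurable_proj
    | succ i => exact (measurable_pi_apply i).comp measurable_subtype_coe
  exact h1.subtype_mk

/-- Invariance under `F` amounts to invariance under `F⁻¹`. -/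
theorem isInvariantOn_F_iff (hD : MeasurableSet D) {g : ℝ → ℝ} (hg : Measurable g)
    (hgf : EqOn g f D) {m : Measure (BackwardOrbit D f)} [IsFiniteMeasure m] :
    IsInvariantOn (Fdomain D f) F m ↔ MeasurePreserving Finv m m := by
  constructor
  · intro h
    refine ⟨measurable_Finv, Measure.ext fun B hB => ?_⟩
    rw [Measure.map_apply measurable_Finv hB, ← h _ (measurable_Finv hB)]
    have e : Fdomain D f ∩ F ⁻¹' (Finv ⁻¹' B) = Fdomain D f ∩ B := by
      ext y
      simp only [mem_inter_iff, mem_preimage]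
      exact and_congr_right fun hy => by rw [Finv_F hy]
    have hu : m (Fdomain D f)ᶜ = 0 := by
      have := h univ MeasurableSet.univ
      rw [preimage_univ, inter_univ] at this
      rw [measure_compl (measurableSet_Fdomain hD) (measure_ne_top _ _), this, tsub_self]
    rw [e, inter_comm, measure_inter_conull hu]
  · intro h A hA
    have e : Finv ⁻¹' (Fdomain D f ∩ F ⁻¹' A) = A := by
      ext y
      simp only [mem_inter_iff, mem_preimage, F_Finv]
      exact and_iff_right (y.2 0).1
    rw [← h.measure_preimage
      ((measurableSet_Fdomain hD).inter (measurable_F hD hg hgf hA)).nullMeasurableSet, e]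

/-- The finite-dimensional marginals of the natural extension. -/
theorem map_frestrictLe {g : ℝ → ℝ} (hg : Measurable g) (hgf : EqOn g f D) {μ : Measure ℝ}
    {m : Measure (BackwardOrbit D f)} (hm : MeasurePreserving Finv m m) (hμ : m.map proj = μ)
    (n : ℕ) :
    (m.map Subtype.val).map (Preorder.frestrictLe (π := fun _ => ℝ) n) =
      μ.map (fun x (i : Finset.Iic n) => g^[n - i] x) := by
  have hφ : Measurable (fun (x : ℝ) (i : Finset.Iic n) => g^[n - i] x) :=
    measurable_pi_lambda _ fun i => hg.iterate _
  have hn := hm.iterate n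
  rw [← hμ, ← hn.map_eq, Measure.map_map measurable_proj hn.measurable,
    Measure.map_map hφ (measurable_proj.comp hn.measurable), hn.map_eq,
    Measure.map_map (by fun_prop) measurable_subtype_coe]
  congr 1
  funext y i
  have key : ∀ j i : ℕ, g^[j] (y.1 (i + j)) = y.1 i := by
    intro j
    induction j with
    | zero => intro i; rfl
    | succ j ih =>
      intro i
      rw [Function.iterate_succ_apply, ← Nat.add_assoc, hgf (y.2 _).1, (y.2 _).2, ih]
  have hi := Finset.mem_Iic.1 i.2
  have := key (n - i) i
  rw [Nat.add_sub_cancel' hi] at this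
  simp only [Function.comp, Preorder.frestrictLe_apply, proj, Finv_iterate_apply, Nat.zero_add]
  exact this.symm

end BackwardOrbit

open BackwardOrbit in
/-- The natural extension of an invariant probability measure exists and is unique. -/
theorem existsUnique_isNaturalExtension {D : Set ℝ} {f : ℝ → ℝ} {μ : Measure ℝ}
    (hD : MeasurableSet D) (hf : ContinuousOn f D) (hprob : IsProbabilityMeasure μ)
    (hinv : IsInvariantOn D f μ) : ∃! μbar, IsNaturalExtension D f μ μbar := by
  classical
  have hDc : ∀ᵐ x ∂μ, x ∈ D := by
    have := hinv univ MeasurableSet.univ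
    rw [preimage_univ, inter_univ] at this
    rw [ae_iff, ← compl_def, measure_compl hD (measure_ne_top _ _), this, tsub_self]
  obtain ⟨g, hg, hgf⟩ : ∃ g : ℝ → ℝ, Measurable g ∧ EqOn g f D :=
    ⟨D.piecewise f 0, hf.measurable_piecewise continuousOn_const hD, piecewise_eqOn _ _ _⟩
  have hgμ : MeasurePreserving g μ μ := by
    refine ⟨hg, Measure.ext fun A hA => ?_⟩
    rw [Measure.map_apply hg hA, ← hinv A hA, ← measure_inter_conull (t := D) hDc]
    congr 1
    ext x
    simp only [mem_inter_iff, mem_preimage, and_comm]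
    exact and_congr_right fun hx => by rw [hgf hx]
  have hφ (n : ℕ) : Measurable (fun (x : ℝ) (i : Finset.Iic n) => g^[n - i] x) :=
    measurable_pi_lambda _ fun i => hg.iterate _
  obtain ⟨P, hP, hPn⟩ := exists_backward_law hgμ
  have hS : MeasurableSet {y : ℕ → ℝ | ∀ i, y (i + 1) ∈ D ∧ f (y (i + 1)) = y i} := by
    have : {y : ℕ → ℝ | ∀ i, y (i + 1) ∈ D ∧ f (y (i + 1)) = y i} =
        ⋂ i, {y : ℕ → ℝ | y (i + 1) ∈ D} ∩ {y | g (y (i + 1)) = y i} := by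
      ext y
      simp only [mem_iInter, mem_inter_iff, mem_ofPred_eq]
      exact forall_congr' fun i => and_congr_right fun h => by rw [hgf h]
    rw [this]
    exact MeasurableSet.iInter fun i => (measurable_pi_apply (i + 1) hD).inter
      (measurableSet_eq_fun (hg.comp (measurable_pi_apply _)) (measurable_pi_apply _))
  have hPS : ∀ᵐ y ∂P, ∀ i, y (i + 1) ∈ D ∧ f (y (i + 1)) = y i := by
    rw [ae_all_iff]
    intro i
    let T : Set ((j : Finset.Iic (i + 1)) → ℝ) :=
      {z | z ⟨i + 1, by simp⟩ ∈ D ∧ g (z ⟨i + 1, by simp⟩) = z ⟨i, by simp⟩}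
    have hp (j : Finset.Iic (i + 1)) :
        Measurable (fun z : (j : Finset.Iic (i + 1)) → ℝ => z j) := measurable_pi_apply j
    have hT : MeasurableSet T :=
      (hp _ hD).inter (measurableSet_eq_fun (hg.comp (hp _)) (hp _))
    have h1 : ∀ᵐ z ∂(P.map (Preorder.frestrictLe (π := fun _ => ℝ) (i + 1))), z ∈ T := by
      rw [hPn]
      refine (ae_map_iff (hφ _).aemeasurable hT).2 ?_
      filter_upwards [hDc] with x hx
      simp [hx]
    have h2 := ae_of_ae_map (by fun_prop) h1
    filter_upwards [h2] with y hy
    exact ⟨hy.1, (hgf hy.1).symm.trans hy.2⟩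
  have hemb : MeasurableEmbedding (Subtype.val : BackwardOrbit D f → (ℕ → ℝ)) :=
    MeasurableEmbedding.subtype_coe hS
  let m : Measure (BackwardOrbit D f) := P.comap Subtype.val
  have hm : m.map Subtype.val = P := by
    rw [hemb.map_comap, Subtype.range_coe_subtype]
    exact Measure.restrict_eq_self_of_ae_mem hPS
  have hmp : IsProbabilityMeasure m :=
    ⟨by rw [← preimage_univ (f := Subtype.val), ← hemb.map_apply, hm, measure_univ]⟩
  have hshift : MeasurePreserving Finv m m := by
    refine ⟨measurable_Finv, ?_⟩
    have hinj : Function.Injective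
        (fun ν : Measure (BackwardOrbit D f) => ν.map Subtype.val) := by
      intro ν₁ ν₂ h
      have := congrArg (Measure.comap (Subtype.val : BackwardOrbit D f → (ℕ → ℝ))) h
      simpa [hemb.comap_map] using this
    apply hinj
    let sh : (ℕ → ℝ) → (ℕ → ℝ) := fun y i => y (i + 1)
    have hsh : Measurable sh := measurable_pi_lambda _ fun i => measurable_pi_apply _
    change (m.map Finv).map Subtype.val = m.map Subtype.val
    rw [Measure.map_map measurable_subtype_coe measurable_Finv]
    change m.map (sh ∘ Subtype.val) = _
    rw [← Measure.map_map hsh measurable_subtype_coe, hm]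
    have : IsProbabilityMeasure (P.map sh) := Measure.isProbabilityMeasure_map hsh.aemeasurable
    refine measure_ext_of_frestrictLe fun n => ?_
    let tl : ((i : Finset.Iic (n + 1)) → ℝ) → ((i : Finset.Iic n) → ℝ) :=
      fun z i => z ⟨i + 1, by simpa using Finset.mem_Iic.1 i.2⟩
    have htl : Measurable tl := measurable_pi_lambda _ fun i => measurable_pi_apply _
    rw [Measure.map_map (by fun_prop) hsh, hPn n]
    change P.map (tl ∘ Preorder.frestrictLe (π := fun _ => ℝ) (n + 1)) = _
    rw [← Measure.map_map htl (by fun_prop), hPn, Measure.map_map htl (hφ _)]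
    congr 1
    funext x i
    simp [tl]
  refine ⟨m, ⟨(isInvariantOn_F_iff hD hg hgf).2 hshift, ?_⟩, ?_⟩
  · have h0 := hPn 0
    have he : Measurable (fun z : (i : Finset.Iic 0) → ℝ => z ⟨0, by simp⟩) :=
      measurable_pi_apply _
    have := congrArg (Measure.map (fun z : (i : Finset.Iic 0) → ℝ => z ⟨0, by simp⟩)) h0
    rw [← hm, Measure.map_map (by fun_prop) measurable_subtype_coe,
      Measure.map_map he (by fun_prop), Measure.map_map he (hφ 0)] at this
    refine Eq.trans this ?_
    exact Measure.map_id
  · intro m' hm'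
    have : IsProbabilityMeasure m' := by
      constructor
      have := congrArg (fun ν : Measure ℝ => ν univ) hm'.map_proj
      simpa [Measure.map_apply measurable_proj MeasurableSet.univ] using this
    have h' := (isInvariantOn_F_iff hD hg hgf).1 hm'.invariant
    have e : m'.map Subtype.val = P := by
      have : IsProbabilityMeasure (m'.map (Subtype.val : BackwardOrbit D f → (ℕ → ℝ))) :=
        Measure.isProbabilityMeasure_map measurable_subtype_coe.aemeasurable
      refine measure_ext_of_frestrictLe fun n => ?_
      rw [map_frestrictLe hg hgf h' hm'.map_proj, hPn]
    rw [← hemb.comap_map m', e]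

/-!
By Birkhoff's theorem, applied to the ergodic map `F⁻¹` of the natural extension, the derivatives
`|Dfⁿ|` along almost every backward orbit `y` grow like `exp (n * χ)`, and `|log |Df (yₙ)||` is
sublinear in `n`. The Hölder conditions of a cusp map bound the distortion of `f` on the ball of
radius `r` around `x` by a multiple of `r ^ ε * exp |log |Df x||`, and while this is small the ball
contains no endpoint of the branch, since `Df` would be near `0` or `±∞` there. Along `y` the
preimages of a ball of radius `s` have radius about `s / |Dfⁿ|`, so their distortions decay
exponentially; for `s` small they add up to at most `1 / 2 < log 2`, and then, by induction on `n`,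
the inverse branches along `y` are defined on the whole ball.
-/

section Birkhoff

variable {X : Type*} {T : X → X} {h : X → ℝ}

/-- The running maxima `max (0, h, h + h ∘ T, …)` of the Birkhoff sums of `h`. -/
noncomputable def birkhoffMax (T : X → X) (h : X → ℝ) (n : ℕ) (x : X) : ℝ :=
  partialSups (fun k => birkhoffSum T h k x) n

theorem monotone_birkhoffMax (x : X) : Monotone fun n => birkhoffMax T h n x :=
  (partialSups fun k => birkhoffSum T h k x).monotone

theorem birkhoffSum_le_birkhoffMax (n : ℕ) (x : X) : birkhoffSum T h n x ≤ birkhoffMax T h n x :=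
  le_partialSups (fun k => birkhoffSum T h k x) n

theorem birkhoffMax_zero : birkhoffMax T h 0 = 0 := by
  ext x
  simp [birkhoffMax]

theorem birkhoffMax_succ (n : ℕ) (x : X) :
    birkhoffMax T h (n + 1) x = max 0 (h x + birkhoffMax T h n (T x)) := by
  have hsucc (n : ℕ) (x : X) : birkhoffMax T h (n + 1) x =
      max (birkhoffMax T h n x) (birkhoffSum T h (n + 1) x) := partialSups_add_one _ n
  induction n with
  | zero => simp [hsucc, birkhoffMax_zero]
  | succ n ih => rw [hsucc, ih, hsucc, birkhoffSum_succ', max_assoc, max_add_add_left]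

theorem birkhoffMax_succ_sub (n : ℕ) (x : X) :
    birkhoffMax T h (n + 1) x - birkhoffMax T h n (T x) = max (-birkhoffMax T h n (T x)) (h x) := by
  rw [birkhoffMax_succ, ← max_sub_sub_right, zero_sub, add_sub_cancel_right]

theorem bddAbove_birkhoffMax_comp_iff (x : X) :
    BddAbove (range fun n => birkhoffMax T h n (T x)) ↔
      BddAbove (range fun n => birkhoffMax T h n x) := by
  simp only [bddAbove_def, forall_mem_range]
  constructor
  · rintro ⟨K, hK⟩
    refine ⟨max 0 (h x + K), fun n => (monotone_birkhoffMax x n.le_succ).trans ?_⟩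
    exact (birkhoffMax_succ n x).trans_le (max_le_max le_rfl (by linarith [hK n]))
  · rintro ⟨K, hK⟩
    refine ⟨K - h x, fun n => ?_⟩
    linarith [hK (n + 1), birkhoffMax_succ (T := T) (h := h) n x,
      le_max_right 0 (h x + birkhoffMax T h n (T x))]

theorem tendsto_max_neg_birkhoffMax {x : X} (hx : ¬ BddAbove (range fun n => birkhoffMax T h n x))
    (c : ℝ) : Tendsto (fun n => max (-birkhoffMax T h n x) c) atTop (𝓝 c) := by
  have hlim : Tendsto (fun n => birkhoffMax T h n x) atTop atTop :=
    tendsto_atTop_atTop_of_monotone (monotone_birkhoffMax x) fun K => by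
      obtain ⟨_, ⟨n, rfl⟩, hn⟩ := not_bddAbove_iff.1 hx K
      exact ⟨n, hn.le⟩
  refine tendsto_const_nhds.congr' ?_
  filter_upwards [hlim.eventually_ge_atTop (-c)] with n hn
  exact (max_eq_right (by linarith)).symm

theorem eventually_birkhoffAverage_lt_of_bddAbove {x : X}
    (hx : BddAbove (range fun n => birkhoffMax T h n x)) {δ : ℝ} (hδ : 0 < δ) :
    ∀ᶠ n : ℕ in atTop, birkhoffAverage ℝ T h n x < δ := by
  obtain ⟨K, hK⟩ := hx
  filter_upwards [eventually_gt_atTop 0,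
    tendsto_natCast_atTop_atTop.eventually_gt_atTop (K / δ)] with n hn hKn
  rw [birkhoffAverage, smul_eq_mul, inv_mul_lt_iff₀ (Nat.cast_pos.2 hn)]
  calc birkhoffSum T h n x ≤ K := (birkhoffSum_le_birkhoffMax n x).trans (hK ⟨n, rfl⟩)
    _ < n * δ := (div_lt_iff₀ hδ).1 hKn

variable [MeasurableSpace X]

theorem measurable_birkhoffMax (hT : Measurable T) (hh : Measurable h) (n : ℕ) :
    Measurable (birkhoffMax T h n) := by
  induction n with
  | zero => exact birkhoffMax_zero ▸ measurable_const
  | succ n ih =>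
    simp only [funext (birkhoffMax_succ n)]
    exact measurable_const.max (hh.add (ih.comp hT))

variable {P : Measure X}

theorem integrable_birkhoffMax (hT : MeasurePreserving T P P) (hi : Integrable h P) (n : ℕ) :
    Integrable (birkhoffMax T h n) P := by
  induction n with
  | zero => exact birkhoffMax_zero ▸ integrable_zero _ _ _
  | succ n ih =>
    simp only [funext (birkhoffMax_succ n)]
    exact (integrable_zero _ _ _).sup (hi.add (hT.integrable_comp_of_integrable ih))

theorem integral_birkhoffMax_succ_sub_nonneg (hT : MeasurePreserving T P P) (hh : Measurable h)
    (hi : Integrable h P) (n : ℕ) :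
    0 ≤ ∫ x, (birkhoffMax T h (n + 1) x - birkhoffMax T h n (T x)) ∂P := by
  have hM := integrable_birkhoffMax hT hi
  have hcomp : ∫ x, birkhoffMax T h n (T x) ∂P = ∫ x, birkhoffMax T h n x ∂P := by
    conv_rhs => rw [← hT.map_eq]
    exact (integral_map hT.measurable.aemeasurable
      (measurable_birkhoffMax hT.measurable hh n).aestronglyMeasurable).symm
  have hcompi : Integrable (fun x => birkhoffMax T h n (T x)) P :=
    hT.integrable_comp_of_integrable (hM n)
  rw [integral_sub (hM _) hcompi, hcomp, sub_nonneg]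
  exact integral_mono (hM _) (hM _) fun x => monotone_birkhoffMax x n.le_succ

theorem integral_nonneg_of_ae_not_bddAbove_birkhoffMax (hT : MeasurePreserving T P P)
    (hh : Measurable h) (hi : Integrable h P)
    (hu : ∀ᵐ x ∂P, ¬ BddAbove (range fun n => birkhoffMax T h n x)) : 0 ≤ ∫ x, h x ∂P := by
  have hlim : Tendsto (fun n => ∫ x, max (-birkhoffMax T h n (T x)) (h x) ∂P) atTop
      (𝓝 (∫ x, h x ∂P)) := by
    refine integral_tendsto_of_tendsto_of_antitone
      (fun n => (hT.integrable_comp_of_integrable (integrable_birkhoffMax hT hi n)).neg.sup hi) hi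
      (ae_of_all _ fun x m n hmn => ?_) ?_
    · exact max_le_max (neg_le_neg (monotone_birkhoffMax _ hmn)) le_rfl
    · filter_upwards [hT.quasiMeasurePreserving.ae hu] with x hx
      exact tendsto_max_neg_birkhoffMax hx (h x)
  simp only [← birkhoffMax_succ_sub] at hlim
  exact ge_of_tendsto' hlim (integral_birkhoffMax_succ_sub_nonneg hT hh hi)

theorem ae_bddAbove_birkhoffMax [IsFiniteMeasure P] (hT : MeasurePreserving T P P)
    (hh : Measurable h) (hi : Integrable h P)
    (hneg : ∀ A, MeasurableSet A → T ⁻¹' A = A → P A ≠ 0 → ∫ x in A, h x ∂P < 0) :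
    ∀ᵐ x ∂P, BddAbove (range fun n => birkhoffMax T h n x) := by
  set A : Set X := {x | ¬ BddAbove (range fun n => birkhoffMax T h n x)}
  have hA : MeasurableSet A :=
    (measurableSet_bddAbove_range fun n => measurable_birkhoffMax hT.measurable hh n).compl
  have hTA : T ⁻¹' A = A := by
    ext x
    exact not_congr (bddAbove_birkhoffMax_comp_iff x)
  have hTr : MeasurePreserving T (P.restrict A) (P.restrict A) := by
    simpa only [hTA] using hT.restrict_preimage hA
  rw [ae_iff]
  by_contra hPA
  exact (hneg A hA hTA hPA).not_ge (integral_nonneg_of_ae_not_bddAbove_birkhoffMax hTr hh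
    hi.restrict (ae_restrict_mem hA))

open MeasurableSpace in
theorem ae_eventually_birkhoffAverage_lt [IsFiniteMeasure P] (hT : MeasurePreserving T P P)
    (hh : Measurable h) (hi : Integrable h P) {δ : ℝ} (hδ : 0 < δ) :
    ∀ᵐ x ∂P, ∀ᶠ n : ℕ in atTop, birkhoffAverage ℝ T h n x < (P[h | invariants T]) x + δ := by
  set φ := P[h | invariants T]
  have hφm : Measurable[invariants T] φ := stronglyMeasurable_condExp.measurable
  have hφi : Integrable φ P := integrable_condExp
  have hφT : φ ∘ T = φ := comp_eq_of_measurable_invariants hφm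
  have hbdd : ∀ᵐ x ∂P, BddAbove (range fun n => birkhoffMax T (h - φ - fun _ => δ / 2) n x) := by
    refine ae_bddAbove_birkhoffMax hT ((hh.sub (hφm.mono (invariants_le T) le_rfl)).sub_const _)
      ((hi.sub hφi).sub (integrable_const _)) fun A hA hTA hPA => ?_
    have hmean : ∫ x in A, φ x ∂P = ∫ x in A, h x ∂P :=
      setIntegral_condExp (invariants_le T) hi ⟨hA, hTA⟩
    have hpos : 0 < P.real A := ENNReal.toReal_pos hPA (measure_ne_top _ _)
    calc ∫ x in A, (h - φ - fun _ => δ / 2 : X → ℝ) x ∂P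
        = ∫ x in A, (h - φ) x ∂P - ∫ _ in A, δ / 2 ∂P :=
          integral_sub (hi.sub hφi).restrict (integrable_const _)
      _ = -(P.real A * (δ / 2)) := by
          rw [integral_sub' hi.restrict hφi.restrict, hmean, setIntegral_const]
          simp
      _ < 0 := by rw [neg_lt_zero]; positivity
  filter_upwards [hbdd] with x hx
  filter_upwards [eventually_gt_atTop 0,
    eventually_birkhoffAverage_lt_of_bddAbove hx (half_pos hδ)] with n hn hlt
  have hn0 : (n : ℝ) ≠ 0 := Nat.cast_ne_zero.2 hn.ne'
  simp only [birkhoffAverage_sub, Pi.sub_apply] at hlt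
  rw [birkhoffAverage_of_comp_eq ℝ hφT hn0,
    birkhoffAverage_of_comp_eq ℝ (g := fun _ => δ / 2) rfl hn0] at hlt
  linarith

theorem ae_tendsto_birkhoffAverage [IsFiniteMeasure P] (hT : MeasurePreserving T P P)
    (hh : Measurable h) (hi : Integrable h P) :
    ∀ᵐ x ∂P, Tendsto (birkhoffAverage ℝ T h · x) atTop
      (𝓝 ((P[h | MeasurableSpace.invariants T]) x)) := by
  have hlt : ∀ᵐ x ∂P, ∀ k : ℕ, ∀ᶠ n in atTop, birkhoffAverage ℝ T h n x <
      (P[h | MeasurableSpace.invariants T]) x + 1 / (k + 1) :=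
    ae_all_iff.2 fun k => ae_eventually_birkhoffAverage_lt hT hh hi Nat.one_div_pos_of_nat
  have hgt : ∀ᵐ x ∂P, ∀ k : ℕ, ∀ᶠ n in atTop, birkhoffAverage ℝ T (-h) n x <
      (P[-h | MeasurableSpace.invariants T]) x + 1 / (k + 1) :=
    ae_all_iff.2 fun k =>
      ae_eventually_birkhoffAverage_lt hT hh.neg hi.neg Nat.one_div_pos_of_nat
  filter_upwards [hlt, hgt, condExp_neg h (MeasurableSpace.invariants T)] with x hx hx' hneg
  rw [Metric.tendsto_nhds]
  intro e he
  obtain ⟨k, hk⟩ := exists_nat_one_div_lt he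
  filter_upwards [hx k, hx' k] with n hn hn'
  rw [hneg, birkhoffAverage_neg] at hn'
  simp only [Pi.neg_apply] at hn'
  rw [Real.dist_eq, abs_lt]
  constructor <;> linarith

theorem ae_tendsto_birkhoffAverage_of_ergodic [IsProbabilityMeasure P] (hT : Ergodic T P)
    (hh : Measurable h) (hi : Integrable h P) :
    ∀ᵐ x ∂P, Tendsto (birkhoffAverage ℝ T h · x) atTop (𝓝 (∫ x, h x ∂P)) := by
  have hle := MeasurableSpace.invariants_le T
  have hφm := (stronglyMeasurable_condExp
    (m := MeasurableSpace.invariants T) (μ := P) (f := h)).measurable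
  obtain ⟨c, hc⟩ := hT.ae_eq_const_of_ae_eq_comp_ae
    (hφm.mono hle le_rfl).aestronglyMeasurable
    (EventuallyEq.of_eq (MeasurableSpace.comp_eq_of_measurable_invariants hφm))
  have hmean : c = ∫ x, h x ∂P := by
    rw [← integral_condExp hle, integral_congr_ae hc]
    simp
  filter_upwards [ae_tendsto_birkhoffAverage hT.toMeasurePreserving hh hi, hc] with x hx hcx
  rwa [hcx, Function.const_apply, hmean] at hx

end Birkhoff

section NaturalExtension

theorem IsInvariantOn.ae_mem {X : Type*} [MeasurableSpace X] {D : Set X} {T : X → X} {μ : Measure X}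
    [IsFiniteMeasure μ] (h : IsInvariantOn D T μ) (hD : MeasurableSet D) : ∀ᵐ x ∂μ, x ∈ D := by
  have hμD := h univ MeasurableSet.univ
  rw [preimage_univ, inter_univ] at hμD
  rw [ae_iff, ← compl_def, measure_compl hD (measure_ne_top _ _), hμD, tsub_self]

theorem IsInvariantOn.measurePreserving_of_eqOn {X : Type*} [MeasurableSpace X] {D : Set X}
    {T g : X → X} {μ : Measure X} [IsFiniteMeasure μ] (h : IsInvariantOn D T μ)
    (hD : MeasurableSet D) (hg : Measurable g) (hgT : EqOn g T D) : MeasurePreserving g μ μ := by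
  refine ⟨hg, Measure.ext fun A hA => ?_⟩
  rw [Measure.map_apply hg hA, ← h A hA, ← measure_inter_conull (t := D) (h.ae_mem hD), inter_comm,
    hgT.inter_preimage_eq]

theorem IsErgodicInvariant.ergodic_of_eqOn {X : Type*} [MeasurableSpace X] {D : Set X} {T g : X → X}
    {μ : Measure X} (h : IsErgodicInvariant D T μ) (hD : MeasurableSet D) (hg : Measurable g)
    (hgT : EqOn g T D) : Ergodic g μ := by
  have := h.prob
  have hmp := h.invariant.measurePreserving_of_eqOn hD hg hgT
  refine ⟨hmp, ⟨fun s hs hgs => ?_⟩⟩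
  let E : Set X := ⋂ k : ℕ, g^[k] ⁻¹' D
  have hE : MeasurableSet E := MeasurableSet.iInter fun k => hg.iterate k hD
  have hEc : ∀ᵐ x ∂μ, x ∈ E := by
    simp only [E, mem_iInter]
    exact ae_all_iff.2 fun k =>
      (hmp.iterate k).quasiMeasurePreserving.ae (h.invariant.ae_mem hD)
  have hgE : D ∩ g ⁻¹' E = E := by
    ext x
    simp only [E, mem_inter_iff, mem_preimage, mem_iInter, ← Function.iterate_succ_apply]
    exact Nat.and_forall_add_one (p := fun k => g^[k] x ∈ D)
  have hsE : D ∩ T ⁻¹' (s ∩ E) = s ∩ E := by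
    rw [← hgT.inter_preimage_eq, preimage_inter, hgs, inter_left_comm, hgE]
  have hμE : μ (s ∩ E) = μ s := measure_inter_conull hEc
  rw [eventuallyConst_set']
  rcases h.ergodic _ (hs.inter hE) hsE with h0 | h1
  · exact Or.inl (ae_eq_empty.2 (hμE ▸ h0))
  · right
    rw [ae_eq_univ, prob_compl_eq_zero_iff hs, ← hμE, h1]

namespace BackwardOrbit

variable {D : Set ℝ} {f g : ℝ → ℝ} {m m' : Measure (BackwardOrbit D f)}

theorem measurePreserving_map_proj (hg : Measurable g) (hgf : EqOn g f D)
    (hm : MeasurePreserving Finv m m) : MeasurePreserving g (m.map proj) (m.map proj) := by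
  refine ⟨hg, ?_⟩
  have hsemi : g ∘ proj ∘ Finv = (proj : BackwardOrbit D f → ℝ) :=
    funext fun y => (hgf (y.2 0).1).trans (y.2 0).2
  conv_lhs => rw [← hm.map_eq]
  rw [Measure.map_map measurable_proj measurable_Finv,
    Measure.map_map hg (measurable_proj.comp measurable_Finv), hsemi]

theorem measure_ext_of_map_proj [IsFiniteMeasure m] (hg : Measurable g) (hgf : EqOn g f D)
    (hm : MeasurePreserving Finv m m) (hm' : MeasurePreserving Finv m' m')
    (h : m.map proj = m'.map proj) : m = m' := by
  have hval : m.map Subtype.val = m'.map Subtype.val := by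
    refine measure_ext_of_frestrictLe fun n => ?_
    rw [map_frestrictLe hg hgf hm rfl, map_frestrictLe hg hgf hm' rfl, h]
  ext S hS
  obtain ⟨B, hB, rfl⟩ := hS
  rw [← Measure.map_apply measurable_subtype_coe hB, hval,
    Measure.map_apply measurable_subtype_coe hB]

/-- The restriction of `m` to an invariant set projects to a multiple of the ergodic measure
`m.map proj`, hence is itself the same multiple of `m`. -/
theorem ergodic_Finv [IsFiniteMeasure m] (hgf : EqOn g f D)
    (hg : Ergodic g (m.map proj)) (hm : MeasurePreserving Finv m m) : Ergodic Finv m := by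
  refine ⟨hm, ⟨fun A hA hinv => ?_⟩⟩
  have hmA : MeasurePreserving Finv (m.restrict A) (m.restrict A) := by
    simpa only [hinv] using hm.restrict_preimage hA
  obtain ⟨c, hc⟩ := hg.eq_smul_of_absolutelyContinuous
    (measurePreserving_map_proj hg.measurable hgf hmA)
    ((Measure.absolutelyContinuous_of_le Measure.restrict_le_self).map measurable_proj)
  have hcm : m.restrict A = c • m := measure_ext_of_map_proj hg.measurable hgf hmA
    (hm.smul_measure c) (hc.trans (Measure.map_smul _ _ _).symm)
  have hcompl : c * m Aᶜ = 0 := by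
    have hz : m.restrict A Aᶜ = 0 := by
      rw [Measure.restrict_apply hA.compl, compl_inter_self, measure_empty]
    rwa [hcm, Measure.smul_apply, smul_eq_mul] at hz
  rw [eventuallyConst_set']
  rcases mul_eq_zero.1 hcompl with h0 | h0
  · left
    rw [ae_eq_empty, ← Measure.restrict_apply_self, hcm, h0, zero_smul, Measure.coe_zero,
      Pi.zero_apply]
  · exact Or.inr (ae_eq_univ.2 h0)

end BackwardOrbit

open BackwardOrbit in
theorem IsNaturalExtension.ae_tendsto_average {D : Set ℝ} {f : ℝ → ℝ} {μ : Measure ℝ}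
    {m : Measure (BackwardOrbit D f)} (hm : IsNaturalExtension D f μ m) (hD : MeasurableSet D)
    (hf : ContinuousOn f D) (hμ : IsErgodicInvariant D f μ) {φ : ℝ → ℝ} (hφ : Measurable φ)
    (hφi : Integrable φ μ) :
    ∀ᵐ y ∂m, Tendsto (fun n : ℕ => (∑ i ∈ Finset.range n, φ (y.1 (i + 1))) / n) atTop
      (𝓝 (∫ x, φ x ∂μ)) := by
  classical
  have := hμ.prob
  obtain ⟨g, hg, hgf⟩ : ∃ g : ℝ → ℝ, Measurable g ∧ EqOn g f D :=
    ⟨D.piecewise f 0, hf.measurable_piecewise continuousOn_const hD, piecewise_eqOn _ _ _⟩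
  obtain ⟨hinv, rfl⟩ := hm
  have : IsProbabilityMeasure m :=
    Measure.isProbabilityMeasure_of_map (μ := m) proj
  have hF := (isInvariantOn_F_iff hD hg hgf).1 hinv
  have key := ae_tendsto_birkhoffAverage_of_ergodic
    (ergodic_Finv hgf (hμ.ergodic_of_eqOn hD hg hgf) hF) (hφ.comp measurable_proj)
    (hφi.comp_measurable measurable_proj)
  filter_upwards [hF.quasiMeasurePreserving.ae key] with y hy
  rw [integral_map measurable_proj.aemeasurable hφ.aestronglyMeasurable]
  refine hy.congr fun n => ?_
  rw [birkhoffAverage, smul_eq_mul, inv_mul_eq_div, birkhoffSum]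
  simp only [Function.comp_apply, proj, Finv_iterate_apply, Nat.zero_add]
  rfl

end NaturalExtension

section Diffeo

namespace IsC1Diffeo

variable {f g : ℝ → ℝ} {U V W : Set ℝ} {x : ℝ}

theorem differentiableAt (h : IsC1Diffeo f U V) (hx : x ∈ U) : DifferentiableAt ℝ f x :=
  (h.2.2.2.1.differentiableOn one_ne_zero).differentiableAt (h.1.mem_nhds hx)

theorem continuousOn_deriv (h : IsC1Diffeo f U V) : ContinuousOn (deriv f) U :=
  h.2.2.2.1.continuousOn_deriv_of_isOpen h.1 le_rfl

theorem deriv_ne_zero (h : IsC1Diffeo f U V) (hx : x ∈ U) : deriv f x ≠ 0 := by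
  obtain ⟨hU, hV, hfUV, -, g, hg, hgV⟩ := id h
  have hg' : DifferentiableAt ℝ g (f x) :=
    (hgV.differentiableOn one_ne_zero).differentiableAt (hV.mem_nhds (hfUV.mapsTo hx))
  have hcomp : HasDerivAt (g ∘ f) (deriv g (f x) * deriv f x) x :=
    hg'.hasDerivAt.comp x (h.differentiableAt hx).hasDerivAt
  have hid : HasDerivAt (g ∘ f) 1 x :=
    (hasDerivAt_id x).congr_of_eventuallyEq (eventuallyEq_of_mem (hU.mem_nhds hx) hg.1)
  exact right_ne_zero_of_mul_eq_one (hcomp.unique hid)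

theorem comp (hg : IsC1Diffeo g V W) (hf : IsC1Diffeo f U V) : IsC1Diffeo (g ∘ f) U W := by
  obtain ⟨hU, -, hfUV, hfc, f', hf', hfc'⟩ := hf
  obtain ⟨-, hW, hgVW, hgc, g', hg', hgc'⟩ := hg
  have hg'W : MapsTo g' W V := hg'.1.mapsTo hgVW.surjOn
  exact ⟨hU, hW, hgVW.comp hfUV, hgc.comp hfc hfUV.mapsTo, f' ∘ g',
    ⟨hf'.1.comp hg'.1 hfUV.mapsTo, hf'.2.comp hg'.2 hg'W⟩, hfc'.comp hgc' hg'W⟩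

theorem restrict_preimage (hf : IsC1Diffeo f U V) (hW : IsOpen W) (hWV : W ⊆ V) :
    IsC1Diffeo f (U ∩ f ⁻¹' W) W := by
  obtain ⟨hU, -, hfUV, hfc, f', hf', hfc'⟩ := hf
  refine ⟨hfc.continuousOn.isOpen_inter_preimage hU hW, hW, ⟨fun x hx => hx.2,
    hfUV.injOn.mono inter_subset_left, fun w hw => ?_⟩, hfc.mono inter_subset_left, f',
    ⟨hf'.1.mono inter_subset_left, hf'.2.mono hWV⟩, hfc'.mono hWV⟩
  obtain ⟨x, hx, rfl⟩ := hfUV.surjOn (hWV hw)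
  exact ⟨x, ⟨hx, hw⟩, rfl⟩

theorem abs_sub_le_of_le_abs_deriv (h : IsC1Diffeo f U V) (hV : Convex ℝ V) {K : ℝ} (hK : 0 < K)
    (hd : ∀ x ∈ U, K ≤ |deriv f x|) (hx : x ∈ U) {x' : ℝ} (hx' : x' ∈ U) :
    |x' - x| ≤ K⁻¹ * |f x' - f x| := by
  obtain ⟨-, hVo, hfUV, -, g, hg, hgV⟩ := id h
  have hgU : MapsTo g V U := hg.1.mapsTo hfUV.surjOn
  have hg' (w) (hw : w ∈ V) : HasDerivAt g (deriv f (g w))⁻¹ w :=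
    (h.differentiableAt (hgU hw)).hasDerivAt.of_local_left_inverse
      (hgV.continuousOn.continuousAt (hVo.mem_nhds hw)) (h.deriv_ne_zero (hgU hw))
      (eventuallyEq_of_mem (hVo.mem_nhds hw) hg.2)
  have hbound (w) (hw : w ∈ V) : ‖(deriv f (g w))⁻¹‖ ≤ K⁻¹ := by
    rw [norm_inv, Real.norm_eq_abs]
    exact inv_anti₀ hK (hd _ (hgU hw))
  simpa only [hg.1 hx, hg.1 hx', Real.norm_eq_abs] using
    hV.norm_image_sub_le_of_norm_hasDerivWithin_le
      (fun w hw => (hg' w hw).hasDerivWithinAt) hbound (hfUV.mapsTo hx) (hfUV.mapsTo hx')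

end IsC1Diffeo

theorem isC1Diffeo_id {U : Set ℝ} (hU : IsOpen U) : IsC1Diffeo id U U :=
  ⟨hU, hU, bijOn_id _, contDiffOn_id, id, ⟨fun _ _ => rfl, fun _ _ => rfl⟩, contDiffOn_id⟩

theorem ball_subset_image_ball_of_le_deriv {f : ℝ → ℝ} {x r K : ℝ} (hK : 0 < K)
    (hf : ∀ z ∈ Metric.ball x r, DifferentiableAt ℝ f z)
    (hd : ∀ z ∈ Metric.ball x r, K ≤ deriv f z) :
    Metric.ball (f x) (K * r) ⊆ f '' Metric.ball x r := by
  intro w hw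
  rw [Metric.mem_ball, Real.dist_eq] at hw
  obtain ⟨s, hs, hsr⟩ := exists_between ((div_lt_iff₀' hK).2 hw)
  have hs0 : 0 ≤ s := le_trans (by positivity) hs.le
  have hsub : Icc (x - s) (x + s) ⊆ Metric.ball x r := by
    rw [← Real.closedBall_eq_Icc]
    exact Metric.closedBall_subset_ball hsr
  have hc : ContinuousOn f (Icc (x - s) (x + s)) := fun z hz =>
    (hf z (hsub hz)).continuousAt.continuousWithinAt
  have hslope := (convex_Icc (x - s) (x + s)).mul_sub_le_image_sub_of_le_deriv hc
    (fun z hz => (hf z (hsub (interior_subset hz))).differentiableWithinAt)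
    (fun z hz => hd z (hsub (interior_subset hz)))
  have hleft : x - s ∈ Icc (x - s) (x + s) := left_mem_Icc.2 (by linarith)
  have hright : x + s ∈ Icc (x - s) (x + s) := right_mem_Icc.2 (by linarith)
  have hmid : x ∈ Icc (x - s) (x + s) := ⟨by linarith, by linarith⟩
  have hL := hslope _ hleft _ hmid hmid.1
  have hR := hslope _ hmid _ hright hmid.2
  rw [div_lt_iff₀' hK, abs_lt] at hs
  obtain ⟨z, hz, hzw⟩ := intermediate_value_Icc (hleft.2) hc
    (show w ∈ Icc (f (x - s)) (f (x + s)) from ⟨by linarith, by linarith⟩)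
  exact ⟨z, hsub hz, hzw⟩

end Diffeo

section LocalDistortion

theorem abs_sub_le_of_holder_of_abs_le_one {u : ℝ → ℝ} {s : Set ℝ} (hs : s.OrdConnected)
    (hu : ContinuousOn u s) {C ε : ℝ} (hC : 0 ≤ C) (hε : 0 ≤ ε)
    (hH : ∀ x ∈ s, ∀ x' ∈ s, |u x| ≤ 2 → |u x'| ≤ 2 → |u x - u x'| ≤ C * |x - x'| ^ ε)
    {x x' : ℝ} (hx : x ∈ s) (hx' : x' ∈ s) (hux : |u x| ≤ 1) (hr : C * |x' - x| ^ ε ≤ 1 / 4) :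
    |u x' - u x| ≤ C * |x' - x| ^ ε := by
  refine hH _ hx' _ hx ?_ (by linarith)
  by_contra! hux'
  have hsub : uIcc x x' ⊆ s := hs.uIcc_subset hx hx'
  obtain ⟨z, hz, huz : |u z| = 3 / 2⟩ : (3 / 2 : ℝ) ∈ (fun t => |u t|) '' uIcc x x' :=
    intermediate_value_uIcc (hu.mono hsub).abs (mem_uIcc_of_le (by linarith) (by linarith))
  have hzx : |u z - u x| ≤ C * |x' - x| ^ ε :=
    (hH z (hsub hz) x hx (by linarith) (by linarith)).trans <| mul_le_mul_of_nonneg_left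
      (Real.rpow_le_rpow (abs_nonneg _) (abs_sub_left_of_mem_uIcc hz) hε) hC
  linarith [abs_sub_abs_le_abs_sub (u z) (u x)]

theorem abs_log_le_two_mul {w t : ℝ} (ht : t ≤ 1 / 4) (hw : |w - 1| ≤ t) :
    |Real.log w| ≤ 2 * t := by
  obtain ⟨hw1, hw2⟩ := abs_le.1 hw
  have hw0 : 0 < w := by linarith
  have hinv : w⁻¹ ≤ 1 + 2 * t := by
    rw [inv_le_iff_one_le_mul₀ hw0]
    nlinarith
  rw [abs_le]
  constructor <;> linarith [Real.log_le_sub_one_of_pos hw0, Real.one_sub_inv_le_log_of_pos hw0]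

theorem div_pos_and_abs_log_div_le_of_holder {u : ℝ → ℝ} {s : Set ℝ} (hs : s.OrdConnected)
    (hu : ContinuousOn u s) {C ε : ℝ} (hC : 0 ≤ C) (hε : 0 ≤ ε)
    (hH : ∀ x ∈ s, ∀ x' ∈ s, |u x| ≤ 2 → |u x'| ≤ 2 → |u x - u x'| ≤ C * |x - x'| ^ ε)
    {x x' : ℝ} (hx : x ∈ s) (hx' : x' ∈ s) (hux : |u x| ≤ 1) (hux0 : u x ≠ 0)
    (hr : C * |x' - x| ^ ε * |u x|⁻¹ ≤ 1 / 4) :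
    0 < u x' / u x ∧ |Real.log (u x' / u x)| ≤ 2 * (C * |x' - x| ^ ε * |u x|⁻¹) := by
  have hinv : 1 ≤ |u x|⁻¹ := (one_le_inv₀ (abs_pos.2 hux0)).2 hux
  have hr' : C * |x' - x| ^ ε ≤ 1 / 4 := (le_mul_of_one_le_right (by positivity) hinv).trans hr
  have hsub := abs_sub_le_of_holder_of_abs_le_one hs hu hC hε hH hx hx' hux hr'
  have hdiv : |u x' / u x - 1| ≤ C * |x' - x| ^ ε * |u x|⁻¹ := by
    rw [div_sub_one hux0, abs_div, div_eq_mul_inv]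
    gcongr
  exact ⟨by linarith [(abs_le.1 hdiv).1], abs_log_le_two_mul hr hdiv⟩

theorem exp_abs_log_abs_of_le_one {t : ℝ} (ht : t ≠ 0) (ht1 : |t| ≤ 1) :
    Real.exp |Real.log (|t|)| = |t|⁻¹ := by
  rw [abs_of_nonpos (Real.log_nonpos (abs_nonneg _) ht1), Real.exp_neg, Real.exp_log (abs_pos.2 ht)]

theorem mem_Icc_half_two_of_abs_log_le_half {t : ℝ} (ht : 0 < t) (hlog : |Real.log t| ≤ 1 / 2) :
    t ∈ Icc (1 / 2) 2 := by
  obtain ⟨h1, h2⟩ := abs_le.1 hlog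
  constructor
  · rw [← Real.log_le_log_iff (by norm_num) ht, one_div, Real.log_inv]
    linarith [Real.log_two_gt_d9]
  · rw [← Real.log_le_log_iff ht two_pos]
    linarith [Real.log_two_gt_d9]

theorem not_limZeroOrInfinite {φ : ℝ → ℝ} {l : Filter ℝ} [l.NeBot] {c c' : ℝ} (hc : 0 < c)
    (h : ∀ᶠ x in l, |φ x| ∈ Icc c c') : ¬ LimZeroOrInfinite φ l := by
  rintro (h0 | htop | hbot)
  · obtain ⟨x, hx, hx'⟩ := (h.and (h0.abs.eventually_lt_const (by rwa [abs_zero]))).exists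
    exact hx'.not_ge hx.1
  · obtain ⟨x, hx, hx'⟩ := (h.and (htop.eventually_gt_atTop c')).exists
    linarith [hx.2, le_abs_self (φ x)]
  · obtain ⟨x, hx, hx'⟩ := (h.and (hbot.eventually_lt_atBot (-c'))).exists
    linarith [hx.2, neg_le_abs (φ x)]

/-- A branch of a cusp map: an interval `U`, possibly unbounded, on which `f` is a diffeomorphism
satisfying the cusp conditions, the endpoints of `U` being the points of its frontier. -/
structure IsCuspBranch (f : ℝ → ℝ) (U : Set ℝ) (C ε : ℝ) : Prop where
  C_nonneg : 0 ≤ C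
  ε_pos : 0 < ε
  ordConnected : U.OrdConnected
  diffeo : IsC1Diffeo f U (f '' U)
  lim_frontier : ∀ z ∈ frontier U, LimZeroOrInfinite (deriv f) (𝓝[U] z)
  holder : ∀ x ∈ U, ∀ x' ∈ U,
    |deriv f x| ≤ 2 → |deriv f x'| ≤ 2 → |deriv f x - deriv f x'| ≤ C * |x - x'| ^ ε
  holder_inv : ∀ x ∈ U, ∀ x' ∈ U, 2⁻¹ ≤ |deriv f x| → 2⁻¹ ≤ |deriv f x'| →
    |(deriv f x)⁻¹ - (deriv f x')⁻¹| ≤ C * |x - x'| ^ ε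

/-- A bound for the distortion of a cusp branch on the ball of radius `r` around `x`, valid if it is
at most `1 / 2`. -/
noncomputable def localDistortion (f : ℝ → ℝ) (C ε x r : ℝ) : ℝ :=
  2 * (C * r ^ ε * Real.exp |Real.log (|deriv f x|)|)

theorem localDistortion_nonneg {f : ℝ → ℝ} {C ε x r : ℝ} (hC : 0 ≤ C) (hr : 0 ≤ r) :
    0 ≤ localDistortion f C ε x r := by
  unfold localDistortion
  positivity

theorem localDistortion_mono {f : ℝ → ℝ} {C ε x r r' : ℝ} (hC : 0 ≤ C) (hε : 0 ≤ ε) (hr : 0 ≤ r)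
    (hrr' : r ≤ r') : localDistortion f C ε x r ≤ localDistortion f C ε x r' := by
  unfold localDistortion
  gcongr

namespace IsCuspBranch

variable {f : ℝ → ℝ} {U : Set ℝ} {C ε x x' r : ℝ}

theorem deriv_ne_zero (h : IsCuspBranch f U C ε) (hx : x ∈ U) : deriv f x ≠ 0 :=
  h.diffeo.deriv_ne_zero hx

-- The Hölder condition applies to `f'` where `|f'| ≤ 1`, and to `1 / f'` where `|f'| ≥ 1`.
theorem deriv_div_pos_and_abs_log_deriv_div_le (h : IsCuspBranch f U C ε) (hx : x ∈ U)
    (hx' : x' ∈ U) (hr : localDistortion f C ε x |x' - x| ≤ 1 / 2) :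
    0 < deriv f x' / deriv f x ∧
      |Real.log (deriv f x' / deriv f x)| ≤ localDistortion f C ε x |x' - x| := by
  have hcont := h.diffeo.continuousOn_deriv
  have hd := h.deriv_ne_zero hx
  unfold localDistortion at hr ⊢
  rcases le_total |deriv f x| 1 with hd1 | hd1
  · rw [exp_abs_log_abs_of_le_one hd hd1] at hr ⊢
    exact div_pos_and_abs_log_div_le_of_holder h.ordConnected hcont h.C_nonneg h.ε_pos.le h.holder
      hx hx' hd1 hd (by linarith)
  · have hinv : |(deriv f x)⁻¹| ≤ 1 := by
      rw [abs_inv]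
      exact inv_le_one_of_one_le₀ hd1
    have half {z : ℝ} (hz : z ∈ U) (hz2 : |(deriv f z)⁻¹| ≤ 2) : 2⁻¹ ≤ |deriv f z| := by
      rw [abs_inv] at hz2
      exact inv_le_of_inv_le₀ (abs_pos.2 (h.deriv_ne_zero hz)) hz2
    have hexp := exp_abs_log_abs_of_le_one (inv_ne_zero hd) hinv
    rw [abs_inv, Real.log_inv, abs_neg, ← abs_inv] at hexp
    rw [hexp] at hr ⊢
    have key := div_pos_and_abs_log_div_le_of_holder (u := fun z => (deriv f z)⁻¹) h.ordConnected
      (hcont.inv₀ fun z hz => h.deriv_ne_zero hz) h.C_nonneg h.ε_pos.le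
      (fun z hz z' hz' hz2 hz2' => h.holder_inv z hz z' hz' (half hz hz2) (half hz' hz2'))
      hx hx' hinv (inv_ne_zero hd) (by linarith)
    rwa [← inv_div_inv, ← inv_div, inv_pos, Real.log_inv, abs_neg]

theorem abs_log_deriv_sub_le (h : IsCuspBranch f U C ε) (hx : x ∈ U) (hx' : x' ∈ U)
    (hr : localDistortion f C ε x |x' - x| ≤ 1 / 2) :
    |(Real.log |deriv f x'|) - (Real.log |deriv f x|)| ≤ localDistortion f C ε x |x' - x| := by
  rw [Real.log_abs, Real.log_abs, ← Real.log_div (h.deriv_ne_zero hx') (h.deriv_ne_zero hx)]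
  exact (h.deriv_div_pos_and_abs_log_deriv_div_le hx hx' hr).2

theorem deriv_div_mem_Icc (h : IsCuspBranch f U C ε) (hx : x ∈ U) (hx' : x' ∈ U)
    (hr : localDistortion f C ε x r ≤ 1 / 2) (hxr : |x' - x| ≤ r) :
    deriv f x' / deriv f x ∈ Icc (1 / 2) 2 := by
  have hle := (localDistortion_mono h.C_nonneg h.ε_pos.le (abs_nonneg _) hxr).trans hr
  obtain ⟨hpos, hlog⟩ := h.deriv_div_pos_and_abs_log_deriv_div_le hx hx' hle
  exact mem_Icc_half_two_of_abs_log_le_half hpos (hlog.trans hle)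

-- Bounded distortion keeps `|f'|` away from `0` and `∞`, hence the ball away from the endpoints.
theorem ball_subset (h : IsCuspBranch f U C ε) (hx : x ∈ U)
    (hr : localDistortion f C ε x r ≤ 1 / 2) : Metric.ball x r ⊆ U := by
  rcases le_or_gt r 0 with hr0 | hr0
  · simp only [Metric.ball_eq_empty.2 hr0, empty_subset]
  have hd : 0 < |deriv f x| := abs_pos.2 (h.deriv_ne_zero hx)
  refine (convex_ball x r).isPreconnected.subset_of_closure_inter_subset h.diffeo.1
    ⟨x, Metric.mem_ball_self hr0, hx⟩ fun z hz => ?_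
  by_contra hzU
  have : (𝓝[U] z).NeBot := mem_closure_iff_nhdsWithin_neBot.1 hz.1
  refine not_limZeroOrInfinite (c := 1 / 2 * |deriv f x|) (c' := 2 * |deriv f x|) (by positivity)
    ?_ (h.lim_frontier z (h.diffeo.1.frontier_eq ▸ ⟨hz.1, hzU⟩))
  filter_upwards [self_mem_nhdsWithin, nhdsWithin_le_nhds (Metric.isOpen_ball.mem_nhds hz.2)]
    with w hwU hwr
  obtain ⟨h1, h2⟩ := h.deriv_div_mem_Icc hx hwU hr (Metric.mem_ball.1 hwr).le
  have habs := abs_of_pos (one_half_pos.trans_le h1)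
  rw [← habs, abs_div] at h1 h2
  exact ⟨(le_div_iff₀ hd).1 h1, (div_le_iff₀ hd).1 h2⟩

theorem ball_subset_image (h : IsCuspBranch f U C ε) (hx : x ∈ U)
    (hr : localDistortion f C ε x r ≤ 1 / 2) :
    Metric.ball (f x) (|deriv f x| * (r / 2)) ⊆ f '' Metric.ball x r := by
  have hd := h.deriv_ne_zero hx
  have hsub := h.ball_subset hx hr
  have key := ball_subset_image_ball_of_le_deriv (f := fun z => f z / deriv f x) one_half_pos
    (fun z hz => (h.diffeo.differentiableAt (hsub hz)).div_const _)
    (fun z hz => by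
      rw [deriv_div_const]
      exact (h.deriv_div_mem_Icc hx (hsub hz) hr (Metric.mem_ball.1 hz).le).1)
  intro w hw
  have hw' : w / deriv f x ∈ Metric.ball (f x / deriv f x) (1 / 2 * r) := by
    rw [Metric.mem_ball, Real.dist_eq] at hw ⊢
    rw [← sub_div, abs_div, div_lt_iff₀' (abs_pos.2 hd)]
    linarith
  obtain ⟨z, hz, hzw⟩ := key hw'
  exact ⟨z, hz, (div_left_inj' hd).1 hzw⟩

theorem inter_preimage_ball_subset_ball (h : IsCuspBranch f U C ε) (hx : x ∈ U)
    (hr : localDistortion f C ε x r ≤ 1 / 2) :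
    U ∩ f ⁻¹' Metric.ball (f x) (|deriv f x| * (r / 2)) ⊆ Metric.ball x r := by
  rintro w ⟨hwU, hw⟩
  obtain ⟨z, hz, hzw⟩ := h.ball_subset_image hx hr hw
  rwa [← h.diffeo.2.2.1.injOn (h.ball_subset hx hr hz) hwU hzw]

end IsCuspBranch

end LocalDistortion

section PiecewiseCusp

/-- A cusp map on `D` with uniform constants `C`, `ε`: every point of `D` lies in a branch contained
in `D`. Neither the number of branches nor their lengths are restricted. -/
def IsPiecewiseCusp (f : ℝ → ℝ) (D : Set ℝ) (C ε : ℝ) : Prop :=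
  ∀ x ∈ D, ∃ U ⊆ D, x ∈ U ∧ IsCuspBranch f U C ε

namespace IsPiecewiseCusp

variable {f : ℝ → ℝ} {D : Set ℝ} {C ε x : ℝ}

theorem isOpen (hf : IsPiecewiseCusp f D C ε) : IsOpen D :=
  isOpen_iff_mem_nhds.2 fun x hx =>
    let ⟨_, hUD, hxU, hU⟩ := hf x hx
    mem_of_superset (hU.diffeo.1.mem_nhds hxU) hUD

theorem differentiableAt (hf : IsPiecewiseCusp f D C ε) (hx : x ∈ D) : DifferentiableAt ℝ f x :=
  let ⟨_, _, hxU, hU⟩ := hf x hx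
  hU.diffeo.differentiableAt hxU

theorem continuousOn (hf : IsPiecewiseCusp f D C ε) : ContinuousOn f D := fun _ hx =>
  (hf.differentiableAt hx).continuousAt.continuousWithinAt

theorem deriv_ne_zero (hf : IsPiecewiseCusp f D C ε) (hx : x ∈ D) : deriv f x ≠ 0 :=
  let ⟨_, _, hxU, hU⟩ := hf x hx
  hU.deriv_ne_zero hxU

theorem C_nonneg (hf : IsPiecewiseCusp f D C ε) (hx : x ∈ D) : 0 ≤ C :=
  let ⟨_, _, _, hU⟩ := hf x hx
  hU.C_nonneg

theorem ε_pos (hf : IsPiecewiseCusp f D C ε) (hx : x ∈ D) : 0 < ε :=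
  let ⟨_, _, _, hU⟩ := hf x hx
  hU.ε_pos

end IsPiecewiseCusp

theorem IsCuspMapWith.isCuspBranch {ι : Type*} {a b : ℝ} {p q : ι → ℝ} {f : ℝ → ℝ} {C ε : ℝ}
    (hf : IsCuspMapWith a b p q f C ε) (j : ι) : IsCuspBranch f (Ioo (p j) (q j)) C ε where
  C_nonneg := hf.C_pos.le
  ε_pos := hf.ε_pos
  ordConnected := ordConnected_Ioo
  diffeo := hf.basic.diffeo j
  lim_frontier := by
    have hpq := hf.basic.nonempty j
    rw [frontier_Ioo hpq]
    rintro z (rfl | rfl)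
    · rw [nhdsWithin_Ioo_eq_nhdsGT hpq]
      exact hf.basic.lim_left j
    · rw [nhdsWithin_Ioo_eq_nhdsLT hpq]
      exact hf.basic.lim_right j
  holder := hf.holder j
  holder_inv := by simpa only [one_div] using hf.holder_inv j

theorem IsCuspMapWith.isPiecewiseCusp {ι : Type*} {a b : ℝ} {p q : ι → ℝ} {f : ℝ → ℝ} {C ε : ℝ}
    (hf : IsCuspMapWith a b p q f C ε) : IsPiecewiseCusp f (cuspDomain p q) C ε := fun _ hx =>
  let ⟨j, hj⟩ := mem_iUnion.1 hx
  ⟨Ioo (p j) (q j), subset_iUnion (fun j => Ioo (p j) (q j)) j, hj, hf.isCuspBranch j⟩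

end PiecewiseCusp

section Pullback

theorem log_abs_deriv_comp {g f : ℝ → ℝ} {x : ℝ} (hg : deriv g (f x) ≠ 0) (hf : deriv f x ≠ 0) :
    Real.log |deriv (g ∘ f) x| = Real.log |deriv g (f x)| + Real.log |deriv f x| := by
  rw [deriv_comp x (differentiableAt_of_deriv_ne_zero hg) (differentiableAt_of_deriv_ne_zero hf),
    abs_mul, Real.log_mul (abs_ne_zero.2 hg) (abs_ne_zero.2 hf)]

namespace BackwardOrbit

variable {D : Set ℝ} {f : ℝ → ℝ}

theorem iterate_apply (y : BackwardOrbit D f) (n : ℕ) : f^[n] (y.1 n) = y.1 0 := by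
  induction n with
  | zero => rfl
  | succ n ih => rw [Function.iterate_succ_apply, (y.2 n).2, ih]

theorem proj_Finv_iterate (y : BackwardOrbit D f) (n : ℕ) : (Finv^[n] y).proj = y.1 n := by
  rw [proj, Finv_iterate_apply, Nat.zero_add]

theorem hasDerivAt_iterate (hf : ∀ x ∈ D, DifferentiableAt ℝ f x) (y : BackwardOrbit D f) (n : ℕ) :
    HasDerivAt f^[n] (∏ i ∈ Finset.range n, deriv f (y.1 (i + 1))) (y.1 n) := by
  induction n with
  | zero => simpa using hasDerivAt_id _
  | succ n ih =>
    rw [Finset.prod_range_succ, Function.iterate_succ]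
    rw [← (y.2 n).2] at ih
    exact ih.comp _ (hf _ (y.2 n).1).hasDerivAt

theorem deriv_iterate (hf : ∀ x ∈ D, deriv f x ≠ 0) (y : BackwardOrbit D f) (n : ℕ) :
    deriv f^[n] (y.1 n) = ∏ i ∈ Finset.range n, deriv f (y.1 (i + 1)) :=
  (y.hasDerivAt_iterate (fun x hx => differentiableAt_of_deriv_ne_zero (hf x hx)) n).deriv

theorem deriv_iterate_succ (hf : ∀ x ∈ D, deriv f x ≠ 0) (y : BackwardOrbit D f) (n : ℕ) :
    deriv f^[n + 1] (y.1 (n + 1)) = deriv f^[n] (y.1 n) * deriv f (y.1 (n + 1)) := by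
  rw [y.deriv_iterate hf, y.deriv_iterate hf, Finset.prod_range_succ]

theorem deriv_iterate_ne_zero (hf : ∀ x ∈ D, deriv f x ≠ 0) (y : BackwardOrbit D f) (n : ℕ) :
    deriv f^[n] (y.1 n) ≠ 0 := by
  rw [y.deriv_iterate hf]
  exact Finset.prod_ne_zero_iff.2 fun i _ => hf _ (y.2 i).1

theorem log_abs_deriv_iterate (hf : ∀ x ∈ D, deriv f x ≠ 0) (y : BackwardOrbit D f) (n : ℕ) :
    Real.log |deriv f^[n] (y.1 n)| = ∑ i ∈ Finset.range n, Real.log |deriv f (y.1 (i + 1))| := by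
  rw [y.deriv_iterate hf, Finset.abs_prod, Real.log_prod]
  exact fun i _ => abs_ne_zero.2 (hf _ (y.2 i).1)

-- A point of `W n` extends uniquely to a backward orbit in the `W k`: the preimages of its image in
-- `W 0` under the bijections `f^[k]` are compatible by injectivity.
theorem proj_image_Finv_iterate {W : ℕ → Set ℝ} (hb : ∀ n, BijOn f^[n] (W n) (W 0))
    (hW : ∀ n, W (n + 1) ⊆ D ∩ f ⁻¹' W n) (n : ℕ) :
    proj '' (Finv^[n] '' {y : BackwardOrbit D f | ∀ k, y.1 k ∈ W k}) = W n := by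
  ext x
  constructor
  · rintro ⟨-, ⟨y, hy, rfl⟩, rfl⟩
    rw [proj_Finv_iterate]
    exact hy n
  · intro hx
    have hw := (hb n).mapsTo hx
    choose z hz hzw using fun k => (hb k).surjOn hw
    refine ⟨_, ⟨⟨z, fun k => ⟨(hW k (hz (k + 1))).1, ?_⟩⟩, hz, rfl⟩, ?_⟩
    · refine (hb k).injOn (hW k (hz (k + 1))).2 (hz k) ?_
      rw [hzw k, ← Function.iterate_succ_apply, hzw]
    · rw [proj_Finv_iterate]
      exact (hb n).injOn (hz n) hx (hzw n)

/-- The bound for the distortion of `f` between the `n + 1`st and the `n`th pullback along `y` of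
the ball of radius `s` around `y₀`. These pullbacks have radius at most `2 * s / |Dfⁿ|`; the extra
factor `2` leaves room for the distortion of the next branch. -/
noncomputable def distortionBound (C ε : ℝ) (y : BackwardOrbit D f) (s : ℝ) (n : ℕ) : ℝ :=
  localDistortion f C ε (y.1 (n + 1)) (4 * s / |deriv f^[n + 1] (y.1 (n + 1))|)

variable {C ε s : ℝ} {y : BackwardOrbit D f} {n : ℕ} {U W : Set ℝ}

theorem distortionBound_nonneg (hC : 0 ≤ C) (y : BackwardOrbit D f) (hs : 0 ≤ s) (n : ℕ) :
    0 ≤ y.distortionBound C ε s n :=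
  localDistortion_nonneg hC (by positivity)

theorem distortionBound_eq_mul (y : BackwardOrbit D f) (hs : 0 ≤ s) (n : ℕ) :
    y.distortionBound C ε s n = s ^ ε * y.distortionBound C ε 1 n := by
  have hscale : 4 * s / |deriv f^[n + 1] (y.1 (n + 1))| =
      s * (4 * 1 / |deriv f^[n + 1] (y.1 (n + 1))|) := by ring
  unfold distortionBound localDistortion
  rw [hscale, Real.mul_rpow hs (by positivity)]
  ring

theorem distortionBound_le_of_sum_le (hC : 0 ≤ C) (hs : 0 ≤ s)
    (hsum : ∑ i ∈ Finset.range (n + 1), y.distortionBound C ε s i ≤ 1 / 2) :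
    y.distortionBound C ε s n ≤ 1 / 2 :=
  (Finset.single_le_sum (f := y.distortionBound C ε s)
    (fun i _ => y.distortionBound_nonneg hC hs i) (Finset.self_mem_range_succ n)).trans hsum

theorem abs_deriv_mul_pullback_radius (hf : ∀ x ∈ D, deriv f x ≠ 0) (y : BackwardOrbit D f)
    (s : ℝ) (n : ℕ) :
    |deriv f (y.1 (n + 1))| * (4 * s / |deriv f^[n + 1] (y.1 (n + 1))| / 2) =
      2 * s / |deriv f^[n] (y.1 n)| := by
  have hn := abs_pos.2 (y.deriv_iterate_ne_zero hf n)
  have hn' := abs_pos.2 (hf _ (y.2 n).1)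
  rw [y.deriv_iterate_succ hf, abs_mul]
  field_simp
  ring

theorem subset_image_branch (hf : ∀ x ∈ D, deriv f x ≠ 0) (hU : IsCuspBranch f U C ε)
    (hy : y.1 (n + 1) ∈ U) (hn : y.distortionBound C ε s n ≤ 1 / 2)
    (hW : W ⊆ Metric.ball (y.1 n) (2 * s / |deriv f^[n] (y.1 n)|)) : W ⊆ f '' U := by
  rw [← y.abs_deriv_mul_pullback_radius hf, ← (y.2 n).2] at hW
  exact hW.trans ((hU.ball_subset_image hy hn).trans (image_mono (hU.ball_subset hy hn)))

theorem abs_log_deriv_sub_le_distortionBound (hf : ∀ x ∈ D, deriv f x ≠ 0)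
    (hU : IsCuspBranch f U C ε) (hy : y.1 (n + 1) ∈ U) (hn : y.distortionBound C ε s n ≤ 1 / 2)
    (hW : W ⊆ Metric.ball (y.1 n) (2 * s / |deriv f^[n] (y.1 n)|)) {x : ℝ}
    (hx : x ∈ U ∩ f ⁻¹' W) :
    |(Real.log |deriv f x|) - (Real.log |deriv f (y.1 (n + 1))|)| ≤ y.distortionBound C ε s n := by
  rw [← y.abs_deriv_mul_pullback_radius hf, ← (y.2 n).2] at hW
  have hxr := Metric.mem_ball.1 (hU.inter_preimage_ball_subset_ball hy hn ⟨hx.1, hW hx.2⟩)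
  have hmono := localDistortion_mono (f := f) (x := y.1 (n + 1)) hU.C_nonneg hU.ε_pos.le
    (abs_nonneg _) hxr.le
  exact (hU.abs_log_deriv_sub_le hy hx.1 (hmono.trans hn)).trans hmono

end BackwardOrbit

/-- `W` is a neighbourhood of `yₙ` which `fⁿ` maps diffeomorphically onto the ball of radius `s`
around `y₀`, with distortion bounded by the sum of the first `n` distortion bounds along `y`. -/
structure IsControlledPullback {D : Set ℝ} {f : ℝ → ℝ} (C ε : ℝ) (y : BackwardOrbit D f) (s : ℝ)
    (n : ℕ) (W : Set ℝ) : Prop where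
  diffeo : IsC1Diffeo f^[n] W (Metric.ball y.proj s)
  mem : y.1 n ∈ W
  abs_log_sub_le : ∀ x ∈ W, |(Real.log |deriv f^[n] x|) - (Real.log |deriv f^[n] (y.1 n)|)| ≤
    ∑ i ∈ Finset.range n, y.distortionBound C ε s i

namespace IsControlledPullback

variable {D : Set ℝ} {f : ℝ → ℝ} {C ε s : ℝ} {y : BackwardOrbit D f} {n : ℕ} {U W : Set ℝ}

theorem ball (hs : 0 < s) : IsControlledPullback C ε y s 0 (Metric.ball y.proj s) where
  diffeo := isC1Diffeo_id Metric.isOpen_ball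
  mem := Metric.mem_ball_self hs
  abs_log_sub_le := by simp

theorem subset_ball (h : IsControlledPullback C ε y s n W)
    (hsum : ∑ i ∈ Finset.range n, y.distortionBound C ε s i ≤ 1 / 2) :
    W ⊆ Metric.ball (y.1 n) (2 * s / |deriv f^[n] (y.1 n)|) := by
  intro x hx
  have hD := abs_pos.2 (h.diffeo.deriv_ne_zero h.mem)
  have hderiv (z) (hz : z ∈ W) : |deriv f^[n] (y.1 n)| / 2 ≤ |deriv f^[n] z| := by
    rw [← Real.log_le_log_iff (by positivity) (abs_pos.2 (h.diffeo.deriv_ne_zero hz)),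
      Real.log_div hD.ne' two_ne_zero]
    linarith [(abs_le.1 ((h.abs_log_sub_le z hz).trans hsum)).1, Real.log_two_gt_d9]
  have hcontr := h.diffeo.abs_sub_le_of_le_abs_deriv (convex_ball _ _) (half_pos hD) hderiv h.mem hx
  have himage : |f^[n] x - f^[n] (y.1 n)| < s := by
    rw [y.iterate_apply]
    exact h.diffeo.2.2.1.mapsTo hx
  refine hcontr.trans_lt ((mul_lt_mul_of_pos_left himage (by positivity)).trans_eq ?_)
  field_simp

theorem inter_preimage (h : IsControlledPullback C ε y s n W) (hf : ∀ x ∈ D, deriv f x ≠ 0)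
    (hs : 0 ≤ s) (hU : IsCuspBranch f U C ε) (hy : y.1 (n + 1) ∈ U)
    (hsum : ∑ i ∈ Finset.range (n + 1), y.distortionBound C ε s i ≤ 1 / 2) :
    IsControlledPullback C ε y s (n + 1) (U ∩ f ⁻¹' W) := by
  have hn := BackwardOrbit.distortionBound_le_of_sum_le hU.C_nonneg hs hsum
  rw [Finset.sum_range_succ] at hsum
  have hball := h.subset_ball (by linarith [y.distortionBound_nonneg (ε := ε) hU.C_nonneg hs n])
  have hmem : y.1 (n + 1) ∈ U ∩ f ⁻¹' W := ⟨hy, by rw [mem_preimage, (y.2 n).2]; exact h.mem⟩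
  have hlog (x) (hx : x ∈ U ∩ f ⁻¹' W) : Real.log |deriv f^[n + 1] x| =
      (Real.log |deriv f^[n] (f x)|) + Real.log |deriv f x| :=
    log_abs_deriv_comp (h.diffeo.deriv_ne_zero hx.2) (hU.deriv_ne_zero hx.1)
  refine ⟨h.diffeo.comp (hU.diffeo.restrict_preimage h.diffeo.1
    (BackwardOrbit.subset_image_branch hf hU hy hn hball)), hmem, fun x hx => ?_⟩
  rw [hlog x hx, hlog _ hmem, (y.2 n).2, add_sub_add_comm, Finset.sum_range_succ]
  exact (abs_add_le _ _).trans (add_le_add (h.abs_log_sub_le _ hx.2)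
    (BackwardOrbit.abs_log_deriv_sub_le_distortionBound hf hU hy hn hball hx))

end IsControlledPullback

/-- The pullback of `B` along the branches of `f` on `U 0, …, U (n - 1)`. -/
def branchPullback (f : ℝ → ℝ) (U : ℕ → Set ℝ) (B : Set ℝ) : ℕ → Set ℝ
  | 0 => B
  | n + 1 => U n ∩ f ⁻¹' branchPullback f U B n

namespace IsPiecewiseCusp

variable {f : ℝ → ℝ} {D : Set ℝ} {C ε s : ℝ}

theorem exists_isControlledPullback (hf : IsPiecewiseCusp f D C ε) (y : BackwardOrbit D f)
    (hs : 0 < s) (hsum : ∀ n, ∑ i ∈ Finset.range n, y.distortionBound C ε s i ≤ 1 / 2) :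
    ∃ W : ℕ → Set ℝ, W 0 = Metric.ball y.proj s ∧ (∀ n, W (n + 1) ⊆ D ∩ f ⁻¹' W n) ∧
      (∀ n, IsControlledPullback C ε y s n (W n)) ∧
      ∀ n, ∀ x ∈ W (n + 1), |(Real.log |deriv f x|) - (Real.log |deriv f (y.1 (n + 1))|)| ≤
        y.distortionBound C ε s n := by
  have hf' (x) (hx : x ∈ D) : deriv f x ≠ 0 := hf.deriv_ne_zero hx
  choose U hUD hyU hU using fun n => hf _ (y.2 n).1
  have hW (n) : IsControlledPullback C ε y s n (branchPullback f U (Metric.ball y.proj s) n) := by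
    induction n with
    | zero => exact .ball hs
    | succ n ih => exact ih.inter_preimage hf' hs.le (hU n) (hyU n) (hsum _)
  exact ⟨branchPullback f U (Metric.ball y.proj s), rfl,
    fun n => inter_subset_inter_left _ (hUD n), hW, fun n x hx =>
      BackwardOrbit.abs_log_deriv_sub_le_distortionBound hf' (hU n) (hyU n)
        (BackwardOrbit.distortionBound_le_of_sum_le (hU n).C_nonneg hs.le (hsum _))
        ((hW n).subset_ball (hsum n)) hx⟩

theorem exists_pullback (hf : IsPiecewiseCusp f D C ε) (y : BackwardOrbit D f) (hs : 0 < s)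
    (hsum : ∀ n, ∑ i ∈ Finset.range n, y.distortionBound C ε s i ≤ 1 / 2) :
    ∃ V : Set (BackwardOrbit D f),
      (y ∈ V ∧ BackwardOrbit.proj '' V = Metric.ball y.proj s) ∧
      (∀ n : ℕ, IsC1Diffeo f^[n] (BackwardOrbit.proj '' (BackwardOrbit.Finv^[n] '' V))
        (BackwardOrbit.proj '' V)) ∧
      (∀ y' ∈ V, ∀ n, |(Real.log |deriv f (BackwardOrbit.Finv^[n + 1] y').proj|) -
        (Real.log |deriv f (BackwardOrbit.Finv^[n + 1] y).proj|)| ≤ y.distortionBound C ε s n) ∧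
      ∀ n, volume (BackwardOrbit.proj '' (BackwardOrbit.Finv^[n] '' V)) ≤
        ENNReal.ofReal (4 * s / |deriv f^[n] (y.1 n)|) := by
  obtain ⟨W, hW0, hWD, hW, hlog⟩ := hf.exists_isControlledPullback y hs hsum
  have himage (n : ℕ) := BackwardOrbit.proj_image_Finv_iterate
    (fun n => hW0 ▸ (hW n).diffeo.2.2.1) hWD n
  have himage0 := (himage 0).trans hW0
  rw [Function.iterate_zero, image_id] at himage0
  refine ⟨{y | ∀ k, y.1 k ∈ W k}, ⟨fun k => (hW k).mem, himage0⟩, fun n => ?_, fun y' hy' n => ?_,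
    fun n => ?_⟩
  · rw [himage, himage0]
    exact (hW n).diffeo
  · rw [BackwardOrbit.proj_Finv_iterate, BackwardOrbit.proj_Finv_iterate]
    exact hlog n _ (hy' (n + 1))
  · rw [himage]
    refine (measure_mono ((hW n).subset_ball (hsum n))).trans_eq ?_
    rw [Real.volume_ball]
    ring_nf

end IsPiecewiseCusp

end Pullback

section Growth

theorem summable_exp_of_tendsto_div {a : ℕ → ℝ} {c : ℝ} (hc : c < 0)
    (h : Tendsto (fun n : ℕ => a n / n) atTop (𝓝 c)) : Summable fun n => Real.exp (a n) := by
  have hgeom : Summable fun n : ℕ => Real.exp (n * (c / 2)) :=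
    Real.summable_exp_nat_mul_iff.2 (by linarith)
  refine hgeom.of_norm_bounded_eventually_nat ?_
  filter_upwards [h.eventually_lt_const (by linarith : c < c / 2), eventually_gt_atTop 0]
    with n hn hn0
  rw [div_lt_iff₀ (by exact_mod_cast hn0)] at hn
  rw [Real.norm_eq_abs, Real.abs_exp, Real.exp_le_exp]
  linarith

theorem tendsto_shift_div {a : ℕ → ℝ} {c : ℝ} (h : Tendsto (fun n : ℕ => a n / n) atTop (𝓝 c)) :
    Tendsto (fun n : ℕ => a (n + 1) / n) atTop (𝓝 c) := by
  have hratio : Tendsto (fun n : ℕ => 1 + 1 / (n : ℝ)) atTop (𝓝 1) := by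
    simpa only [add_zero] using tendsto_one_div_atTop_nhds_zero_nat.const_add (1 : ℝ)
  have hmul := ((tendsto_add_atTop_iff_nat 1).2 h).mul hratio
  rw [mul_one] at hmul
  refine hmul.congr' ?_
  filter_upwards [eventually_ne_atTop 0] with n hn
  push_cast
  field_simp

/-- The sum of the relative deviations of `d n` from the bounds `exp (n * (χ + η))` and
`exp (n * (χ - η))`; the summand `1` makes the resulting estimates strict. -/
noncomputable def growthBound (d : ℕ → ℝ) (χ η : ℝ) : ℝ :=
  1 + ∑' n : ℕ, (d n * Real.exp (-(n * (χ + η))) + Real.exp (n * (χ - η)) / d n)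

theorem growthBound_pos {d : ℕ → ℝ} (hd : ∀ n, 0 ≤ d n) (χ η : ℝ) : 0 < growthBound d χ η := by
  have : 0 ≤ ∑' n : ℕ, (d n * Real.exp (-(n * (χ + η))) + Real.exp (n * (χ - η)) / d n) :=
    tsum_nonneg fun n => by positivity [hd n]
  unfold growthBound
  positivity

theorem summable_growth {d : ℕ → ℝ} (hd : ∀ n, 0 < d n) {χ η : ℝ} (hη : 0 < η)
    (h : Tendsto (fun n : ℕ => Real.log (d n) / n) atTop (𝓝 χ)) :
    Summable fun n : ℕ => d n * Real.exp (-(n * (χ + η))) + Real.exp (n * (χ - η)) / d n := by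
  refine Summable.add ?_ ?_
  · have hlim : Tendsto (fun n : ℕ => (Real.log (d n) - n * (χ + η)) / n) atTop
        (𝓝 (χ - (χ + η))) := by
      refine (h.sub_const (χ + η)).congr' ?_
      filter_upwards [eventually_ne_atTop 0] with n hn
      field_simp
    refine (summable_exp_of_tendsto_div (by linarith) hlim).congr fun n => ?_
    rw [sub_eq_add_neg, Real.exp_add, Real.exp_log (hd n)]
  · have hlim : Tendsto (fun n : ℕ => (n * (χ - η) - Real.log (d n)) / n) atTop
        (𝓝 (χ - η - χ)) := by
      refine (h.const_sub (χ - η)).congr' ?_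
      filter_upwards [eventually_ne_atTop 0] with n hn
      field_simp
    refine (summable_exp_of_tendsto_div (by linarith) hlim).congr fun n => ?_
    rw [Real.exp_sub, Real.exp_log (hd n)]

theorem lt_growthBound {d : ℕ → ℝ} (hd : ∀ n, 0 < d n) {χ η : ℝ} (hη : 0 < η)
    (h : Tendsto (fun n : ℕ => Real.log (d n) / n) atTop (𝓝 χ)) (n : ℕ) :
    (growthBound d χ η)⁻¹ * Real.exp (n * (χ - η)) < d n ∧
      d n < growthBound d χ η * Real.exp (n * (χ + η)) := by
  have hterm (k : ℕ) : 0 < d k * Real.exp (-(k * (χ + η))) := mul_pos (hd k) (Real.exp_pos _)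
  have hterm' (k : ℕ) : 0 < Real.exp (k * (χ - η)) / d k := div_pos (Real.exp_pos _) (hd k)
  have hsum := (summable_growth hd hη h).le_tsum n fun k _ => (add_pos (hterm k) (hterm' k)).le
  have hupper : d n * Real.exp (-(n * (χ + η))) < growthBound d χ η := by
    unfold growthBound
    linarith [hterm' n]
  have hlower : Real.exp (n * (χ - η)) / d n < growthBound d χ η := by
    unfold growthBound
    linarith [hterm n]
  rw [div_lt_iff₀ (hd n)] at hlower
  rw [Real.exp_neg, ← div_eq_mul_inv, div_lt_iff₀ (Real.exp_pos _)] at hupper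
  exact ⟨(inv_mul_lt_iff₀ (growthBound_pos (fun k => (hd k).le) χ η)).2 hlower, hupper⟩

theorem inv_lt_growthBound_mul {d : ℕ → ℝ} (hd : ∀ n, 0 < d n) {χ η : ℝ} (hη : 0 < η)
    (h : Tendsto (fun n : ℕ => Real.log (d n) / n) atTop (𝓝 χ)) (n : ℕ) :
    (d n)⁻¹ < growthBound d χ η * Real.exp (-(n * (χ - η))) := by
  have hpos := growthBound_pos (fun k => (hd k).le) χ η
  have hinv := inv_strictAnti₀ (by positivity) (lt_growthBound hd hη h n).1
  rwa [mul_inv, inv_inv, ← Real.exp_neg] at hinv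

end Growth

section Radius

namespace BackwardOrbit

variable {D : Set ℝ} {f : ℝ → ℝ} {C ε χ : ℝ}

-- Up to a constant, the `n`th term is `exp (|log |Df (y (n + 1))|| - ε * log |Df^[n + 1]|)`, with
-- exponent divided by `n` tending to `-ε * χ`.
theorem summable_distortionBound (hf : ∀ x ∈ D, deriv f x ≠ 0) (hε : 0 < ε) (hχ : 0 < χ)
    {y : BackwardOrbit D f}
    (h : Tendsto (fun n : ℕ => (Real.log |deriv f^[n] (y.1 n)|) / n) atTop (𝓝 χ)) :
    Summable (y.distortionBound C ε 1) := by
  set L : ℕ → ℝ := fun n => Real.log |deriv f^[n] (y.1 n)| with hL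
  have hshift := tendsto_shift_div h
  have hlim : Tendsto (fun n : ℕ => (-(ε * L (n + 1)) + |L (n + 1) - L n|) / n) atTop
      (𝓝 (-(ε * χ) + |χ - χ|)) := by
    refine ((hshift.const_mul ε).neg.add (hshift.sub h).abs).congr fun n => ?_
    rw [← sub_div, abs_div, Nat.abs_cast]
    ring
  rw [sub_self, abs_zero, add_zero] at hlim
  have hsum := summable_exp_of_tendsto_div (neg_neg_of_pos (mul_pos hε hχ)) hlim
  refine (hsum.mul_left (2 * C * 4 ^ ε)).congr fun n => ?_
  have hpos := abs_pos.2 (y.deriv_iterate_ne_zero hf (n + 1))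
  have hlog : L (n + 1) - L n = Real.log |deriv f (y.1 (n + 1))| := by
    simp only [hL, y.log_abs_deriv_iterate hf, Finset.sum_range_succ, add_sub_cancel_left]
  have hexp : Real.exp (-(ε * L (n + 1))) = (|deriv f^[n + 1] (y.1 (n + 1))| ^ ε)⁻¹ := by
    rw [Real.exp_neg, Real.rpow_def_of_pos hpos, mul_comm]
  rw [hlog, Real.exp_add, hexp, distortionBound, localDistortion,
    Real.div_rpow (by norm_num) hpos.le, mul_one]
  ring

/-- A radius for which the distortion bounds along `y` add up to at most `1 / 2`. -/
noncomputable def pullbackRadius (C ε : ℝ) (y : BackwardOrbit D f) : ℝ :=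
  min (1 / 4) ((1 / (2 * (∑' n, y.distortionBound C ε 1 n + 1))) ^ (1 / ε))

theorem pullbackRadius_le (y : BackwardOrbit D f) : y.pullbackRadius C ε ≤ 1 / 4 :=
  min_le_left _ _

theorem pullbackRadius_pos (hC : 0 ≤ C) (y : BackwardOrbit D f) : 0 < y.pullbackRadius C ε := by
  have : 0 ≤ ∑' n, y.distortionBound C ε 1 n :=
    tsum_nonneg fun n => y.distortionBound_nonneg hC zero_le_one n
  unfold pullbackRadius
  positivity

theorem hasSum_distortionBound_pullbackRadius (hC : 0 ≤ C) {y : BackwardOrbit D f}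
    (hy : Summable (y.distortionBound C ε 1)) :
    HasSum (y.distortionBound C ε (y.pullbackRadius C ε))
      (y.pullbackRadius C ε ^ ε * ∑' n, y.distortionBound C ε 1 n) := by
  simpa only [← y.distortionBound_eq_mul (pullbackRadius_pos hC y).le] using
    hy.hasSum.mul_left (y.pullbackRadius C ε ^ ε)

theorem pullbackRadius_rpow_mul_tsum_le (hC : 0 ≤ C) (hε : 0 < ε) (y : BackwardOrbit D f) :
    y.pullbackRadius C ε ^ ε * ∑' n, y.distortionBound C ε 1 n ≤ 1 / 2 := by
  have hnonneg : 0 ≤ ∑' n, y.distortionBound C ε 1 n :=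
    tsum_nonneg fun n => y.distortionBound_nonneg hC zero_le_one n
  have hle : y.pullbackRadius C ε ^ ε ≤ 1 / (2 * (∑' n, y.distortionBound C ε 1 n + 1)) := by
    refine (Real.rpow_le_rpow (pullbackRadius_pos hC y).le (min_le_right _ _) hε.le).trans_eq ?_
    rw [← Real.rpow_mul (by positivity), one_div_mul_cancel hε.ne', Real.rpow_one]
  refine (mul_le_mul_of_nonneg_right hle hnonneg).trans ?_
  rw [div_mul_eq_mul_div, div_le_iff₀ (by positivity)]
  linarith

theorem measurable_abs_deriv_iterate (n : ℕ) :
    Measurable fun y : BackwardOrbit D f => |deriv f^[n] (y.1 n)| :=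
  ((measurable_deriv f^[n]).comp ((measurable_pi_apply n).comp measurable_subtype_coe)).norm

theorem measurable_distortionBound (s : ℝ) (n : ℕ) :
    Measurable fun y : BackwardOrbit D f => y.distortionBound C ε s n := by
  have hiter := measurable_abs_deriv_iterate (f := f) (D := D) (n + 1)
  have hderiv : Measurable fun y : BackwardOrbit D f => deriv f (y.1 (n + 1)) :=
    (measurable_deriv f).comp ((measurable_pi_apply (n + 1)).comp measurable_subtype_coe)
  exact ((((measurable_const.div hiter).pow_const ε).const_mul C).mul
    hderiv.norm.log.norm.exp).const_mul 2

theorem measurable_pullbackRadius :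
    Measurable (pullbackRadius C ε : BackwardOrbit D f → ℝ) := by
  have htsum : Measurable fun y : BackwardOrbit D f => ∑' n, y.distortionBound C ε 1 n :=
    Measurable.tsum fun n => measurable_distortionBound 1 n
  exact measurable_const.min ((measurable_const.div ((htsum.add_const 1).const_mul 2)).pow_const _)

theorem measurable_growthBound (χ η : ℝ) :
    Measurable fun y : BackwardOrbit D f => growthBound (fun n => |deriv f^[n] (y.1 n)|) χ η :=
  Measurable.const_add (Measurable.tsum fun n =>
    ((measurable_abs_deriv_iterate n).mul_const _).add
      (measurable_const.div (measurable_abs_deriv_iterate n))) 1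

end BackwardOrbit

theorem IsPiecewiseCusp.ae_tendsto_log_abs_deriv_iterate {f : ℝ → ℝ} {D : Set ℝ} {C ε : ℝ}
    (hf : IsPiecewiseCusp f D C ε) {μ : Measure ℝ} (hμ : IsErgodicInvariant D f μ)
    (hint : Integrable (fun x => Real.log |deriv f x|) μ) {μbar : Measure (BackwardOrbit D f)}
    (hμbar : IsNaturalExtension D f μ μbar) :
    ∀ᵐ y ∂μbar, Tendsto (fun n : ℕ => (Real.log |deriv f^[n] (y.1 n)|) / n) atTop
      (𝓝 (∫ x, Real.log |deriv f x| ∂μ)) := by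
  simpa only [BackwardOrbit.log_abs_deriv_iterate fun _ => hf.deriv_ne_zero, Real.norm_eq_abs] using
    hμbar.ae_tendsto_average hf.isOpen.measurableSet hf.continuousOn hμ
      (measurable_deriv f).norm.log hint

theorem IsPiecewiseCusp.exists_pullback_of_tendsto {f : ℝ → ℝ} {D : Set ℝ} {C ε : ℝ}
    (hf : IsPiecewiseCusp f D C ε) {y : BackwardOrbit D f} {χ : ℝ} (hχ : 0 < χ)
    (h : Tendsto (fun n : ℕ => (Real.log |deriv f^[n] (y.1 n)|) / n) atTop (𝓝 χ)) :
    ∃ V : Set (BackwardOrbit D f),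
      (y ∈ V ∧ BackwardOrbit.proj '' V = Metric.ball y.proj (y.pullbackRadius C ε)) ∧
      (∀ n : ℕ, IsC1Diffeo f^[n] (BackwardOrbit.proj '' (BackwardOrbit.Finv^[n] '' V))
        (BackwardOrbit.proj '' V)) ∧
      (∀ y' ∈ V,
        Summable (fun i : ℕ => |(Real.log |deriv f (BackwardOrbit.Finv^[i + 1] y').proj|) -
          (Real.log |deriv f (BackwardOrbit.Finv^[i + 1] y).proj|)|) ∧
        ∑' i : ℕ, |(Real.log |deriv f (BackwardOrbit.Finv^[i + 1] y').proj|) -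
          (Real.log |deriv f (BackwardOrbit.Finv^[i + 1] y).proj|)| < Real.log 2) ∧
      ∀ n, volume (BackwardOrbit.proj '' (BackwardOrbit.Finv^[n] '' V)) ≤
        ENNReal.ofReal |deriv f^[n] (y.1 n)|⁻¹ := by
  have hC := hf.C_nonneg (y.2 0).1
  have hε := hf.ε_pos (y.2 0).1
  have hα := BackwardOrbit.pullbackRadius_pos (ε := ε) hC y
  have hsum := BackwardOrbit.hasSum_distortionBound_pullbackRadius hC
    (BackwardOrbit.summable_distortionBound (fun _ => hf.deriv_ne_zero) hε hχ h)
  have hhalf := BackwardOrbit.pullbackRadius_rpow_mul_tsum_le hC hε y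
  obtain ⟨V, hV, hdiffeo, hlog, hvol⟩ := hf.exists_pullback y hα fun n =>
    (sum_le_hasSum _ (fun i _ => y.distortionBound_nonneg hC hα.le i) hsum).trans hhalf
  refine ⟨V, hV, hdiffeo, fun y' hy' => ?_, fun n => (hvol n).trans (ENNReal.ofReal_le_ofReal ?_)⟩
  · have hsummable := hsum.summable.of_nonneg_of_le (fun n => abs_nonneg _) (hlog y' hy')
    refine ⟨hsummable, (hasSum_le (hlog y' hy') hsummable.hasSum hsum).trans_lt ?_⟩
    linarith [Real.log_two_gt_d9]
  · rw [← one_div]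
    gcongr
    linarith [y.pullbackRadius_le (C := C) (ε := ε)]

end Radius

theorem theorem16_general {D : Set ℝ} {f : ℝ → ℝ} {C ε : ℝ} (hf : IsPiecewiseCusp f D C ε)
    (μ : Measure ℝ) (hμ : IsErgodicInvariant D f μ)
    (hint : Integrable (fun x => Real.log |deriv f x|) μ)
    (χ : ℝ) (hχ : χ = ∫ x, Real.log |deriv f x| ∂μ) (hχ_pos : 0 < χ)
    (μbar : Measure (BackwardOrbit D f)) (hμbar : IsNaturalExtension D f μ μbar) :
    ∃ α : BackwardOrbit D f → ℝ,
      Measurable α ∧ (∀ᵐ y ∂μbar, 0 < α y ∧ α y < 1 / 2) ∧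
      ∃ ρ : ℝ → BackwardOrbit D f → ℝ,
        (∀ η > 0, Measurable (ρ η) ∧ ∀ᵐ y ∂μbar, 0 < ρ η y) ∧
        ∀ᵐ y ∂μbar, ∃ V : Set (BackwardOrbit D f),
          (y ∈ V ∧ BackwardOrbit.proj '' V = Metric.ball y.proj (α y)) ∧
          (∀ n : ℕ, 0 < n →
            IsC1Diffeo f^[n] (BackwardOrbit.proj '' (BackwardOrbit.Finv^[n] '' V))
              (BackwardOrbit.proj '' V)) ∧
          (∀ y' ∈ V,
            Summable (fun i : ℕ =>
              |(Real.log |deriv f (BackwardOrbit.Finv^[i + 1] y').proj|) -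
                (Real.log |deriv f (BackwardOrbit.Finv^[i + 1] y).proj|)|) ∧
            ∑' i : ℕ, |(Real.log |deriv f (BackwardOrbit.Finv^[i + 1] y').proj|) -
                (Real.log |deriv f (BackwardOrbit.Finv^[i + 1] y).proj|)| < Real.log 2) ∧
          (∀ η > 0, ∀ n : ℕ,
            (ρ η y)⁻¹ * Real.exp (n * (χ - η)) < |deriv f^[n] (BackwardOrbit.Finv^[n] y).proj| ∧
            |deriv f^[n] (BackwardOrbit.Finv^[n] y).proj| < ρ η y * Real.exp (n * (χ + η)) ∧
            volume (BackwardOrbit.proj '' (BackwardOrbit.Finv^[n] '' V)) ≤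
              ENNReal.ofReal (ρ η y * Real.exp (-(n * (χ - η))))) := by
  have hf' (x) (hx : x ∈ D) : deriv f x ≠ 0 := hf.deriv_ne_zero hx
  have hα (y : BackwardOrbit D f) : 0 < y.pullbackRadius C ε :=
    BackwardOrbit.pullbackRadius_pos (hf.C_nonneg (y.2 0).1) y
  refine ⟨BackwardOrbit.pullbackRadius C ε, BackwardOrbit.measurable_pullbackRadius,
    ae_of_all _ fun y => ⟨hα y, y.pullbackRadius_le.trans_lt (by norm_num)⟩,
    fun η y => growthBound (fun n => |deriv f^[n] (y.1 n)|) χ η,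
    fun η _ => ⟨BackwardOrbit.measurable_growthBound χ η,
      ae_of_all _ fun y => growthBound_pos (fun n => abs_nonneg _) χ η⟩, ?_⟩
  filter_upwards [hf.ae_tendsto_log_abs_deriv_iterate hμ hint hμbar] with y hy
  rw [← hχ] at hy
  have hd (n : ℕ) := abs_pos.2 (y.deriv_iterate_ne_zero hf' n)
  obtain ⟨V, hV, hdiffeo, hlog, hvol⟩ := hf.exists_pullback_of_tendsto hχ_pos hy
  refine ⟨V, hV, fun n _ => hdiffeo n, hlog, fun η hη n => ?_⟩
  rw [y.proj_Finv_iterate]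
  obtain ⟨hlower, hupper⟩ := lt_growthBound hd hη hy n
  exact ⟨hlower, hupper, (hvol n).trans (ENNReal.ofReal_le_ofReal
    (inv_lt_growthBound_mul hd hη hy n).le)⟩

theorem theorem16 {ι : Type*} [Countable ι] (a b : ℝ) (p q : ι → ℝ) (f : ℝ → ℝ)
    (hf : IsCuspMap a b p q f)
    (μ : Measure ℝ) (hμ : IsErgodicInvariant (cuspDomain p q) f μ)
    (hint : Integrable (fun x => Real.log |deriv f x|) μ)
    (χ : ℝ) (hχ : χ = ∫ x, Real.log |deriv f x| ∂μ) (hχ_pos : 0 < χ)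
    (μbar : Measure (BackwardOrbit (cuspDomain p q) f))
    (hμbar : IsNaturalExtension (cuspDomain p q) f μ μbar) :
    ∃ α : BackwardOrbit (cuspDomain p q) f → ℝ,
      Measurable α ∧ (∀ᵐ y ∂μbar, 0 < α y ∧ α y < 1 / 2) ∧
      ∃ ρ : ℝ → BackwardOrbit (cuspDomain p q) f → ℝ,
        (∀ η > 0, Measurable (ρ η) ∧ ∀ᵐ y ∂μbar, 0 < ρ η y) ∧
        ∀ᵐ y ∂μbar, ∃ V : Set (BackwardOrbit (cuspDomain p q) f),
          (y ∈ V ∧ BackwardOrbit.proj '' V = Metric.ball y.proj (α y)) ∧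
          (∀ n : ℕ, 0 < n →
            IsC1Diffeo f^[n] (BackwardOrbit.proj '' (BackwardOrbit.Finv^[n] '' V))
              (BackwardOrbit.proj '' V)) ∧
          (∀ y' ∈ V,
            Summable (fun i : ℕ =>
              |(Real.log |deriv f (BackwardOrbit.Finv^[i + 1] y').proj|) -
                (Real.log |deriv f (BackwardOrbit.Finv^[i + 1] y).proj|)|) ∧
            ∑' i : ℕ, |(Real.log |deriv f (BackwardOrbit.Finv^[i + 1] y').proj|) -
                (Real.log |deriv f (BackwardOrbit.Finv^[i + 1] y).proj|)| < Real.log 2) ∧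
          (∀ η > 0, ∀ n : ℕ,
            (ρ η y)⁻¹ * Real.exp (n * (χ - η)) < |deriv f^[n] (BackwardOrbit.Finv^[n] y).proj| ∧
            |deriv f^[n] (BackwardOrbit.Finv^[n] y).proj| < ρ η y * Real.exp (n * (χ + η)) ∧
            volume (BackwardOrbit.proj '' (BackwardOrbit.Finv^[n] '' V)) ≤
              ENNReal.ofReal (ρ η y * Real.exp (-(n * (χ - η))))) := by
  obtain ⟨C, ε, hf⟩ := hf
  exact theorem16_general hf.isPiecewiseCusp μ hμ hint χ hχ hχ_pos μbar hμbar
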